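/- Let $S$ be a locally Noetherian scheme and let $f\colon X\to S$ be a separated morphism of finite type. Let $\mathbb F$ be the category of coherent sheaves $\mathcal F$ on $X$ whose support is proper over an Artin subscheme of $S$, that is, over a $0$-dimensional Noetherian closed subscheme of $S$; for $r\ge 0$, let $\mathbb F_r$ be the full subcategory of those $\mathcal F$ with $\dim\operatorname{Supp}\mathcal F\le r$. Let $\mathbb K$ be the Grothendieck group of $\mathbb F$, that is, the free Abelian group on the $\mathcal F\in\mathbb F$ modulo the relations $\mathcal F=\mathcal F'+\mathcal F''$ for all short exact sequences $0\to\mathcal F'\to\mathcal F\to\mathcal F''\to 0$ in $\mathbb F$, and let $\mathbb K_r\subset\mathbb K$ be the subgroup generated by the classes of the sheaves in $\mathbb F_r$. Tensoring with an invertible sheaf $\mathcal L$ on $X$ induces an endomorphism $F\mapsto\mathcal L\otimes F$ of $\mathbb K$. Let $\chi\colon\mathbb K\to\mathbb Z$ be the homomorphism induced by the Euler characteristic, which assigns to a sheaf in $\mathbb F$ the alternating sum of the lengths of its cohomology groups. For $\mathcal L\in\operatorname{Pic}(X)$, let $c_1(\mathcal L)$ be the endomorphism of $\mathbb K$ defined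 by $c_1(\mathcal L)F:=F-\mathcal L^{-1}\otimes F$. Theorem (Snapper). Let $r,n\ge 0$, let $\mathcal L_1,\dots,\mathcal L_n\in\operatorname{Pic}(X)$, and let $F\in\mathbb K_r$. Then there is a polynomial in $m_1,\dots,m_n$ with rational coefficients and of total degree at most $r$ whose value at every $(m_1,\dots,m_n)\in\mathbb Z^n$ is $\chi(\mathcal L_1^{\otimes m_1}\otimes\cdots\otimes\mathcal L_n^{\otimes m_n}\otimes F)$. In fact, for all $m_1,\dots,m_n\in\mathbb Z$, $$\chi\bigl(\mathcal L_1^{\otimes m_1}\otimes\cdots\otimes\mathcal L_n^{\otimes m_n}\otimes F\bigr)=\sum a(i_1,\dots,i_n)\binom{m_1+i_1-1}{i_1}\cdots\binom{m_n+i_n-1}{i_n},$$ where the sum is over the integers $i_1,\dots,i_n\ge 0$ with $\sum_j i_j\le r$, where $a(i_1,\dots,i_n):=\chi\bigl(c_1(\mathcal L_1)^{i_1}\cdots c_1(\mathcal L_n)^{i_n}F\bigr)$, and where $\binom{t}{i}:=t(t-1)\cdots(t-i+1)/i!$ for every integer $t$. -/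

import Mathlib

open CategoryTheory MonoidalCategory Opposite TensorProduct

universe u v₁ u₁

namespace Snapper

/-- The map on tensor products induced by two semilinear maps. -/
noncomputable def semiTensor {R R' : Type u} [CommRing R] [CommRing R'] (φ : R →+* R')
    {A N A' N' : Type u} [AddCommGroup A] [Module R A] [AddCommGroup N] [Module R N]
    [AddCommGroup A'] [Module R' A'] [AddCommGroup N'] [Module R' N']
    (a : A →ₛₗ[φ] A') (n : N →ₛₗ[φ] N') : A ⊗[R] N →+ A' ⊗[R'] N' :=
  TensorProduct.liftAddHom
    { toFun x := ((TensorProduct.mk R' A' N' (a x)).toAddMonoidHom).comp n.toAddMonoidHom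
      map_zero' := by ext; simp
      map_add' x y := by ext; simp }
    (fun r x y ↦ by simp)

@[simp] lemma semiTensor_tmul {R R' : Type u} [CommRing R] [CommRing R'] (φ : R →+* R')
    {A N A' N' : Type u} [AddCommGroup A] [Module R A] [AddCommGroup N] [Module R N]
    [AddCommGroup A'] [Module R' A'] [AddCommGroup N'] [Module R' N']
    (a : A →ₛₗ[φ] A') (n : N →ₛₗ[φ] N') (x : A) (y : N) :
    semiTensor φ a n (x ⊗ₜ y) = a x ⊗ₜ n y := rfl

lemma exists_finset_ker_tensor {R : Type u} [CommRing R] {A B N : Type u} [AddCommGroup A]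
    [Module R A] [AddCommGroup B] [Module R B] [AddCommGroup N] [Module R N] (g : A →ₗ[R] B)
    (x : A ⊗[R] N) (hx : g.rTensor N x = 0) :
    ∃ s : Finset B, ∀ {R' : Type u} [CommRing R'] (φ : R →+* R') {A' B' N' : Type u}
      [AddCommGroup A'] [Module R' A'] [AddCommGroup B'] [Module R' B'] [AddCommGroup N']
      [Module R' N'] (g' : A' →ₗ[R'] B') (a : A →ₛₗ[φ] A') (b : B →ₛₗ[φ] B') (n : N →ₛₗ[φ] N'),
      (∀ z, g' (a z) = b (g z)) → (∀ q ∈ s, b q ∈ LinearMap.range g') →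
      semiTensor φ a n x ∈ LinearMap.range (g'.ker.subtype.rTensor N') := by
  obtain ⟨A₀, hA₀, x₀, rfl⟩ := TensorProduct.exists_of_fg x
  have hQ₀ : (A₀.map g).FG := hA₀.map g
  obtain ⟨Q, hQ, ⟨s, rfl⟩, h⟩ := TensorProduct.eq_of_fg_of_subtype_eq (N := N) hQ₀
    (t := (g.submoduleMap A₀).rTensor N x₀) (t' := 0) (by
      rw [map_zero, ← LinearMap.comp_apply, ← LinearMap.rTensor_comp]
      rw [← LinearMap.comp_apply, ← LinearMap.rTensor_comp] at hx
      exact hx)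
  refine ⟨s, fun {R'} _ φ {A' B' N'} _ _ _ _ _ _ g' a b n hab hs ↦ ?_⟩
  have hb : ∀ q : Submodule.span R (s : Set B), b q ∈ LinearMap.range g' := by
    rintro ⟨q, hq⟩
    have : Submodule.span R (s : Set B) ≤ (LinearMap.range g').comap b :=
      Submodule.span_le.2 hs
    exact this hq
  let b' : Submodule.span R (s : Set B) →ₛₗ[φ] LinearMap.range g' :=
    { toFun q := ⟨b q, hb q⟩
      map_add' _ _ := by ext; simp
      map_smul' _ _ := by ext; simp }
  have key : ∀ z : A₀ ⊗[R] N, g'.rangeRestrict.rTensor N'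
      (semiTensor φ a n (A₀.subtype.rTensor N z)) = semiTensor φ b' n
        ((Submodule.inclusion hQ).rTensor N ((g.submoduleMap A₀).rTensor N z)) := by
    intro z
    induction z with
    | zero => simp
    | add z w hz hw => simp only [map_add, hz, hw]
    | tmul z w =>
      simp only [LinearMap.rTensor_tmul, semiTensor_tmul]
      congr 1
      ext
      simp [b', hab]
  have ex : Function.Exact (g'.ker.subtype) g'.rangeRestrict := by
    intro z
    simp [Subtype.ext_iff]
  refine (rTensor_exact N' ex g'.surjective_rangeRestrict _).1 ?_
  rw [key, h, map_zero, map_zero]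

section
variable {C : Type u₁} [Category.{v₁} C] {J : GrothendieckTopology C}
  {R : Cᵒᵖ ⥤ CommRingCat.{u}}

/-- The restriction maps of a presheaf of modules as semilinear maps. -/
noncomputable def resₛₗ (P : PresheafOfModules.{u} (R ⋙ forget₂ _ RingCat)) {X Y : Cᵒᵖ} (i : X ⟶ Y) :
    P.obj X →ₛₗ[(R.map i).hom] P.obj Y where
  toFun := P.map i
  map_add' := map_add _
  map_smul' r m := P.map_smul i r m

lemma tensor_map_eq (P M : PresheafOfModules.{u} (R ⋙ forget₂ _ RingCat)) {X Y : Cᵒᵖ} (i : X ⟶ Y)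
    (x : (P.obj X ⊗[R.obj X] M.obj X : Type u)) :
    (P ⊗ M).map i x = semiTensor (R.map i).hom (resₛₗ P i) (resₛₗ M i) x := by
  induction x with
  | zero => exact (map_zero ((P ⊗ M).map i).hom).trans (map_zero (semiTensor _ _ _)).symm
  | add x y hx hy =>
    exact (map_add ((P ⊗ M).map i).hom x y).trans
      ((congrArg₂ _ hx hy).trans (map_add (semiTensor _ _ _) x y).symm)
  | tmul p m => rfl

lemma whiskerRight_app_eq {P Q : PresheafOfModules.{u} (R ⋙ forget₂ _ RingCat)} (f : P ⟶ Q)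
    (M : PresheafOfModules.{u} (R ⋙ forget₂ _ RingCat)) {X : Cᵒᵖ}
    (x : (P.obj X ⊗[R.obj X] M.obj X : Type u)) :
    (f ▷ M).app X x = (f.app X).hom.rTensor (M.obj X) x := rfl

lemma locSurj_iff {P Q : PresheafOfModules.{u} (R ⋙ forget₂ _ RingCat)} (f : P ⟶ Q) :
    Presheaf.IsLocallySurjective J ((PresheafOfModules.toPresheaf _).map f) ↔
    ∀ (U : C) (s : Q.obj (op U)), ∃ S ∈ J U, ∀ ⦃V⦄ (i : V ⟶ U), S i →
      ∃ t : P.obj (op V), f.app (op V) t = Q.map i.op s := by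
  constructor
  · intro h U s
    exact ⟨_, h.imageSieve_mem (U := U) s, fun V i hi ↦ hi⟩
  · intro h
    constructor
    intro U s
    obtain ⟨S, hS, h⟩ := h U s
    exact J.superset_covering (fun V i hi ↦ h i hi) hS

lemma locInj_iff {P Q : PresheafOfModules.{u} (R ⋙ forget₂ _ RingCat)} (f : P ⟶ Q) :
    Presheaf.IsLocallyInjective J ((PresheafOfModules.toPresheaf _).map f) ↔
    ∀ (U : C) (s : P.obj (op U)), f.app (op U) s = 0 → ∃ S ∈ J U, ∀ ⦃V⦄ (i : V ⟶ U), S i →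
      P.map i.op s = 0 := by
  constructor
  · intro h U s hs
    refine ⟨_, h.equalizerSieve_mem (X := op U) s 0 (by erw [map_zero]; exact hs), fun V i hi ↦ ?_⟩
    have : P.map i.op s = P.map i.op 0 := hi
    rw [this, map_zero]
  · intro h
    constructor
    intro U s t hst
    change P.obj U at s t
    have hst : f.app U s = f.app U t := hst
    obtain ⟨S, hS, h⟩ := h U.unop (s - t) (by erw [map_sub, hst, sub_self])
    refine J.superset_covering (fun V i hi ↦ ?_) hS
    have := h i hi
    rw [map_sub, sub_eq_zero] at this
    exact this

/-- Tensoring with a presheaf of modules preserves local surjectivity. -/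
lemma locSurj_whiskerRight {P Q : PresheafOfModules.{u} (R ⋙ forget₂ _ RingCat)} (f : P ⟶ Q)
    (M : PresheafOfModules.{u} (R ⋙ forget₂ _ RingCat))
    (hf : Presheaf.IsLocallySurjective J ((PresheafOfModules.toPresheaf _).map f)) :
    Presheaf.IsLocallySurjective J ((PresheafOfModules.toPresheaf _).map (f ▷ M)) := by
  rw [locSurj_iff] at hf ⊢
  intro U s
  change (Q.obj (op U) ⊗[R.obj (op U)] M.obj (op U) : Type u) at s
  induction s with
  | zero => exact ⟨⊤, J.top_mem _, fun V i _ ↦ ⟨0, (map_zero ((f ▷ M).app (op V)).hom).trans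
      (map_zero ((Q ⊗ M).map i.op).hom).symm⟩⟩
  | add x y hx hy =>
    obtain ⟨S, hS, h⟩ := hx
    obtain ⟨T, hT, h'⟩ := hy
    refine ⟨S ⊓ T, J.intersection_covering hS hT, fun V i hi ↦ ?_⟩
    obtain ⟨t, ht⟩ := h i hi.1
    obtain ⟨t', ht'⟩ := h' i hi.2
    exact ⟨t + t', by erw [map_add, ht, ht', map_add]; rfl⟩
  | tmul q m =>
    obtain ⟨S, hS, h⟩ := hf U q
    refine ⟨S, hS, fun V i hi ↦ ?_⟩
    obtain ⟨t, ht⟩ := h i hi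
    refine ⟨(t ⊗ₜ[R.obj (op V)] (M.map i.op m : M.obj (op V)) :), ?_⟩
    have : (f ▷ M).app (op V) (t ⊗ₜ[R.obj (op V)] (M.map i.op m : M.obj (op V)) :) =
      ((f.app (op V) t : Q.obj (op V)) ⊗ₜ[R.obj (op V)] (M.map i.op m : M.obj (op V)) :) := rfl
    rw [this, ht]
    rfl

lemma locInj_whiskerRight {P Q : PresheafOfModules.{u} (R ⋙ forget₂ _ RingCat)} (f : P ⟶ Q)
    (M : PresheafOfModules.{u} (R ⋙ forget₂ _ RingCat))
    (hf : Presheaf.IsLocallySurjective J ((PresheafOfModules.toPresheaf _).map f))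
    (hf' : Presheaf.IsLocallyInjective J ((PresheafOfModules.toPresheaf _).map f)) :
    Presheaf.IsLocallyInjective J ((PresheafOfModules.toPresheaf _).map (f ▷ M)) := by
  rw [locSurj_iff] at hf
  rw [locInj_iff] at hf' ⊢
  -- elements coming from the kernel of `f` are locally zero
  have aux : ∀ (U : C) (y : LinearMap.ker (f.app (op U)).hom ⊗[R.obj (op U)] M.obj (op U)),
      ∃ S ∈ J U, ∀ ⦃V⦄ (i : V ⟶ U), S i →
      semiTensor (R.map i.op).hom (resₛₗ P i.op) (resₛₗ M i.op)
        ((LinearMap.ker (f.app (op U)).hom).subtype.rTensor (M.obj (op U)) y) = 0 := by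
    intro U y
    induction y with
    | zero => exact ⟨⊤, J.top_mem _, fun V i _ ↦ by rw [map_zero, map_zero]⟩
    | add x y hx hy =>
      obtain ⟨S, hS, h⟩ := hx
      obtain ⟨T, hT, h'⟩ := hy
      refine ⟨S ⊓ T, J.intersection_covering hS hT, fun V i hi ↦ ?_⟩
      rw [map_add, map_add, h i hi.1, h' i hi.2, add_zero]
    | tmul p m =>
      obtain ⟨S, hS, h⟩ := hf' U p.1 p.2
      refine ⟨S, hS, fun V i hi ↦ ?_⟩
      have : resₛₗ P i.op p.1 = 0 := h i hi
      simp [this]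
  intro U x hx
  change (P.obj (op U) ⊗[R.obj (op U)] M.obj (op U) : Type u) at x
  obtain ⟨s, hs⟩ := exists_finset_ker_tensor (R := R.obj (op U)) (f.app (op U)).hom x hx
  have cov : ∀ s : Finset (Q.obj (op U)), ∃ S ∈ J U, ∀ ⦃V⦄ (i : V ⟶ U), S i →
      ∀ q ∈ s, Q.map i.op q ∈ LinearMap.range (f.app (op V)).hom := by
    classical
    intro s
    induction s using Finset.induction_on with
    | empty => exact ⟨⊤, J.top_mem _, by simp⟩
    | insert q s _ ih =>
      obtain ⟨S, hS, h⟩ := ih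
      obtain ⟨T, hT, h'⟩ := hf U q
      refine ⟨S ⊓ T, J.intersection_covering hS hT, fun V i hi q' hq' ↦ ?_⟩
      rcases Finset.mem_insert.1 hq' with rfl | hq'
      · exact h' i hi.2
      · exact h i hi.1 q' hq'
  obtain ⟨S, hS, h⟩ := cov s
  have main : ∀ ⦃V⦄ (i : V ⟶ U), S i → ∃ T ∈ J V, ∀ ⦃W⦄ (j : W ⟶ V), T j →
      (P ⊗ M).map (j ≫ i).op x = 0 := by
    intro V i hi
    obtain ⟨y, hy⟩ := hs (R.map i.op).hom (f.app (op V)).hom (resₛₗ P i.op) (resₛₗ Q i.op)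
      (resₛₗ M i.op) (fun z ↦ PresheafOfModules.naturality_apply f i.op z) (h i hi)
    obtain ⟨T, hT, hT'⟩ := aux V y
    refine ⟨T, hT, fun W j hj ↦ ?_⟩
    have e := hT' j hj
    rw [hy, ← tensor_map_eq, ← tensor_map_eq] at e
    exact ((P ⊗ M).map_comp_apply i.op j.op x).trans e
  choose T hT hT' using main
  exact ⟨Sieve.bind S.1 (fun V i hi ↦ T i hi), J.bind_covering hS (fun V i hi ↦ hT i hi),
    fun W k ⟨V, j, i, hi, hj, e⟩ ↦ by subst e; exact hT' i hi j hj⟩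

variable (J R) in
/-- The morphisms of presheaves of modules that become isomorphisms after sheafification. -/
abbrev modW : MorphismProperty (PresheafOfModules.{u} (R ⋙ forget₂ _ RingCat)) :=
  J.W.inverseImage (PresheafOfModules.toPresheaf _)

instance modW_isMonoidal [J.WEqualsLocallyBijective AddCommGrpCat.{u}] :
    (modW J R).IsMonoidal :=
  have hr : ∀ {P Q : PresheafOfModules.{u} (R ⋙ forget₂ _ RingCat)} (f : P ⟶ Q)
      (_ : modW J R f) (M : PresheafOfModules.{u} (R ⋙ forget₂ _ RingCat)),
      modW J R (f ▷ M) := fun f hf M ↦ by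
    have hs := hf.isLocallySurjective
    have hi := hf.isLocallyInjective
    exact (GrothendieckTopology.W_iff_isLocallyBijective ..).2
      ⟨locInj_whiskerRight f M hs hi, locSurj_whiskerRight f M hs⟩
  { whiskerLeft M _ _ f hf :=
      ((modW J R).arrow_mk_iso_iff (Arrow.isoMk (β_ _ _) (β_ _ _))).1 (hr f hf M)
    whiskerRight f hf M := hr f hf M }

end

section

open AlgebraicGeometry
variable (X : Scheme.{u})

/-- The structure sheaf as a module over itself. -/
noncomputable abbrev unitModule : X.Modules := SheafOfModules.unit X.ringCatSheaf

/-- The structure presheaf of commutative rings, regarded as a presheaf of rings. -/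
noncomputable def ringHomSheaf : X.presheaf ⋙ forget₂ _ RingCat ⟶ X.ringCatSheaf.obj :=
  𝟙 X.ringCatSheaf.obj

instance : IsIso (ringHomSheaf X) := inferInstanceAs (IsIso (𝟙 X.ringCatSheaf.obj))

/-- Sheafification of presheaves of `𝒪_X`-modules. -/
noncomputable def sheafifyModules :
    PresheafOfModules.{u} (X.presheaf ⋙ forget₂ _ RingCat) ⥤ X.Modules :=
  PresheafOfModules.sheafification (ringHomSheaf X)

instance :
    (sheafifyModules X).IsLocalization (modW (Opens.grothendieckTopology X) X.presheaf) :=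
  inferInstanceAs ((PresheafOfModules.sheafification (ringHomSheaf X)).IsLocalization
    ((Opens.grothendieckTopology X).W.inverseImage (PresheafOfModules.toPresheaf _)))

/-- The presheaf of modules underlying a sheaf of modules. -/
noncomputable def presheafModules :
    X.Modules ⥤ PresheafOfModules.{u} (X.presheaf ⋙ forget₂ _ RingCat) :=
  SheafOfModules.forget _ ⋙ PresheafOfModules.restrictScalars (ringHomSheaf X)

/-- Sheafification is left adjoint to the forgetful functor. -/
noncomputable def sheafifyModulesAdj : sheafifyModules X ⊣ presheafModules X :=
  PresheafOfModules.sheafificationAdjunction (ringHomSheaf X)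

instance : IsIso (sheafifyModulesAdj X).counit :=
  inferInstanceAs (IsIso (PresheafOfModules.sheafificationAdjunction (ringHomSheaf X)).counit)

/-- A sheaf of modules is the sheafification of its underlying presheaf of modules. -/
noncomputable def sheafifyModulesIso (M : X.Modules) :
    (sheafifyModules X).obj ((presheafModules X).obj M) ≅ M :=
  asIso ((sheafifyModulesAdj X).counit.app M)

/-- The structure sheaf is the unit. -/
noncomputable def unitIso : (sheafifyModules X).obj (𝟙_ _) ≅ unitModule X :=
  sheafifyModulesIso X (unitModule X)

/-- The category of `𝒪_X`-modules, regarded as the localization of the monoidal category of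
presheaves of `𝒪_X`-modules by sheafification. -/
abbrev LocMod := LocalizedMonoidal (sheafifyModules X)
  (modW (Opens.grothendieckTopology X) X.presheaf) (unitIso X)

noncomputable instance modulesMonoidal : MonoidalCategory X.Modules :=
  inferInstanceAs (MonoidalCategory (LocMod X))

noncomputable instance modulesSymmetric : SymmetricCategory X.Modules :=
  inferInstanceAs (SymmetricCategory (LocMod X))

noncomputable instance : (sheafifyModules X).Monoidal :=
  inferInstanceAs (Localization.Monoidal.toMonoidalCategory (sheafifyModules X)
    (modW (Opens.grothendieckTopology X) X.presheaf) (unitIso X)).Monoidal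

/-- The tensor product of two `𝒪_X`-modules is the sheaf associated with the presheaf
`U ↦ M(U) ⊗ N(U)`. -/
noncomputable def tensorIso (M N : X.Modules) :
    M ⊗ N ≅ (sheafifyModules X).obj
      ((presheafModules X).obj M ⊗ (presheafModules X).obj N) :=
  ((sheafifyModulesIso X M).symm ⊗ᵢ (sheafifyModulesIso X N).symm) ≪≫
    Functor.Monoidal.μIso (sheafifyModules X) _ _

end

section

open AlgebraicGeometry TopologicalSpace
variable {X : Scheme.{u}}

/-- The canonical map from the presheaf tensor product to the tensor product is an isomorphism
after sheafification. -/
lemma modW_unit (P : PresheafOfModules.{u} (X.presheaf ⋙ forget₂ _ RingCat)) :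
    modW (Opens.grothendieckTopology X) X.presheaf ((sheafifyModulesAdj X).unit.app P) := by
  change (Opens.grothendieckTopology X).W ((PresheafOfModules.toPresheaf _).map
    ((PresheafOfModules.sheafificationAdjunction (ringHomSheaf X)).unit.app P))
  rw [PresheafOfModules.toPresheaf_map_sheafificationAdjunction_unit_app]
  exact GrothendieckTopology.W_toSheafify _ _

/-- Restriction of presheaves of modules to an open subset. -/
noncomputable abbrev resP (U : X.Opens) :
    PresheafOfModules.{u} (X.presheaf ⋙ forget₂ _ RingCat) ⥤
      PresheafOfModules.{u} (((Over.forget U).op ⋙ X.presheaf) ⋙ forget₂ _ RingCat) :=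
  PresheafOfModules.pushforward₀OfCommRingCat (Over.forget U) X.presheaf

lemma modW_resP (U : X.Opens) {P Q : PresheafOfModules.{u} (X.presheaf ⋙ forget₂ _ RingCat)}
    (f : P ⟶ Q) (hf : modW (Opens.grothendieckTopology X) X.presheaf f) :
    modW ((Opens.grothendieckTopology X).over U) ((Over.forget U).op ⋙ X.presheaf)
      ((resP U).map f) := by
  have hs := hf.isLocallySurjective
  have hi := hf.isLocallyInjective
  refine (GrothendieckTopology.W_iff_isLocallyBijective ..).2 ⟨?_, ?_⟩
  · refine (locInj_iff (R := (Over.forget U).op ⋙ X.presheaf) ((resP U).map f)).2 fun V s h ↦ ?_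
    obtain ⟨S, hS, h⟩ := (locInj_iff f).1 hi V.left s h
    refine ⟨(Sieve.overEquiv V).symm S, ?_, fun W i hW ↦ h i.left ?_⟩
    · exact (GrothendieckTopology.mem_over_iff ..).2 (((Sieve.overEquiv V).apply_symm_apply S).symm ▸ hS)
    · exact Sieve.overEquiv_symm_iff _ _ |>.1 hW
  · refine (locSurj_iff (R := (Over.forget U).op ⋙ X.presheaf) ((resP U).map f)).2 fun V s ↦ ?_
    obtain ⟨S, hS, h⟩ := (locSurj_iff f).1 hs V.left s
    refine ⟨(Sieve.overEquiv V).symm S, ?_, fun W i hW ↦ h i.left ?_⟩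
    · exact (GrothendieckTopology.mem_over_iff ..).2 (((Sieve.overEquiv V).apply_symm_apply S).symm ▸ hS)
    · exact Sieve.overEquiv_symm_iff _ _ |>.1 hW

/-- The presheaf of modules underlying a sheaf of modules over an open subset. -/
noncomputable def presheafOver (U : X.Opens) : SheafOfModules.{u} (X.ringCatSheaf.over U) ⥤
      PresheafOfModules.{u} (((Over.forget U).op ⋙ X.presheaf) ⋙ forget₂ _ RingCat) :=
  SheafOfModules.forget _

instance (U : X.Opens) : (presheafOver U).Full :=
  inferInstanceAs (SheafOfModules.forget (X.ringCatSheaf.over U)).Full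
instance (U : X.Opens) : (presheafOver U).Faithful :=
  inferInstanceAs (SheafOfModules.forget (X.ringCatSheaf.over U)).Faithful

lemma isIso_of_modW (U : X.Opens) {M N : SheafOfModules.{u} (X.ringCatSheaf.over U)} (f : M ⟶ N)
    (hf : modW ((Opens.grothendieckTopology X).over U) ((Over.forget U).op ⋙ X.presheaf)
      ((presheafOver U).map f)) : IsIso f := by
  rw [← isIso_iff_of_reflects_iso f (SheafOfModules.toSheaf _)]
  exact (GrothendieckTopology.W_sheafToPresheaf_map_iff_isIso _ _).1 hf

/-- Restriction to an open subset commutes with passing to the underlying presheaf. -/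
noncomputable def presheafOverIso (U : X.Opens) (M : X.Modules) :
    (presheafOver U).obj (SheafOfModules.over M U) ≅ (resP U).obj ((presheafModules X).obj M) :=
  Iso.refl _

/-- If `L` is trivial over an open subset `U`, then `L ⊗ F` and `F` are isomorphic over `U`. -/
lemma over_tensor_iso (U : X.Opens) (L F : X.Modules)
    (h : Nonempty (SheafOfModules.over L U ≅ SheafOfModules.unit (X.ringCatSheaf.over U))) :
    Nonempty (SheafOfModules.over F U ≅ SheafOfModules.over (L ⊗ F : X.Modules) U) := by
  obtain ⟨e⟩ := h
  let Lp := (presheafModules X).obj L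
  let Fp := (presheafModules X).obj F
  let e₁ : (resP U).obj Lp ≅ 𝟙_ _ := (presheafOverIso U L).symm ≪≫ (presheafOver U).mapIso e
  let e₂ : (resP U).obj (Lp ⊗ Fp) ≅ (resP U).obj Fp :=
    (Functor.Monoidal.μIso (resP U) Lp Fp).symm ≪≫ (e₁ ⊗ᵢ Iso.refl _) ≪≫ λ_ _
  let g : (resP U).obj Fp ⟶ (resP U).obj ((presheafModules X).obj ((sheafifyModules X).obj
      (Lp ⊗ Fp))) := e₂.inv ≫ (resP U).map ((sheafifyModulesAdj X).unit.app (Lp ⊗ Fp))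
  have hg : modW ((Opens.grothendieckTopology X).over U) ((Over.forget U).op ⋙ X.presheaf) g :=
    (MorphismProperty.cancel_left_of_respectsIso _ _ _).2 (modW_resP U _ (modW_unit _))
  let g' : (presheafOver U).obj (SheafOfModules.over F U) ⟶ (presheafOver U).obj
    (SheafOfModules.over ((sheafifyModules X).obj (Lp ⊗ Fp)) U) := g
  obtain ⟨k, hk⟩ := (presheafOver U).map_surjective g'
  have : IsIso k := isIso_of_modW U k (by rw [hk]; exact hg)
  exact ⟨asIso k ≪≫ (SheafOfModules.overFunctor X.ringCatSheaf U).mapIso (tensorIso X L F).symm⟩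
end

section

open AlgebraicGeometry TopologicalSpace Limits
variable {X : Scheme.{u}}

/-- `L` is locally free of rank one: every point has an open neighbourhood on which `L` is
isomorphic to the structure sheaf. -/
def IsLocallyTrivial (L : X.Modules) : Prop :=
  ∀ x : X, ∃ U : X.Opens, x ∈ U ∧
    Nonempty (SheafOfModules.over L U ≅ SheafOfModules.unit (X.ringCatSheaf.over U))

lemma IsLocallyTrivial.of_iso {L M : X.Modules} (h : IsLocallyTrivial L) (e : L ≅ M) :
    IsLocallyTrivial M := fun x ↦ by
  obtain ⟨U, hx, ⟨e'⟩⟩ := h x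
  exact ⟨U, hx, ⟨(SheafOfModules.overFunctor X.ringCatSheaf U).mapIso e.symm ≪≫ e'⟩⟩

lemma isLocallyTrivial_unit : IsLocallyTrivial (unitModule X) := fun _ ↦
  ⟨⊤, trivial, ⟨Iso.refl _⟩⟩

/-- Isomorphisms over an open subset restrict to smaller open subsets. -/
lemma over_iso_of_le {U V : X.Opens} (h : V ≤ U) {M N : X.Modules}
    (e : SheafOfModules.over M U ≅ SheafOfModules.over N U) :
    Nonempty (SheafOfModules.over M V ≅ SheafOfModules.over N V) :=
  ⟨((SheafOfModules.overFunctorMap X.ringCatSheaf (homOfLE h)).app M).symm ≪≫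
    (SheafOfModules.overMap X.ringCatSheaf (homOfLE h)).mapIso e ≪≫
    (SheafOfModules.overFunctorMap X.ringCatSheaf (homOfLE h)).app N⟩

lemma IsLocallyTrivial.tensor {L M : X.Modules} (hL : IsLocallyTrivial L)
    (hM : IsLocallyTrivial M) : IsLocallyTrivial (L ⊗ M) := fun x ↦ by
  obtain ⟨U, hxU, ⟨e⟩⟩ := hL x
  obtain ⟨V, hxV, ⟨e'⟩⟩ := hM x
  obtain ⟨a⟩ := over_iso_of_le (N := unitModule X) (inf_le_left : U ⊓ V ≤ U) e
  obtain ⟨b⟩ := over_iso_of_le (N := unitModule X) (inf_le_right : U ⊓ V ≤ V) e'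
  obtain ⟨c⟩ := over_tensor_iso (U ⊓ V) L M ⟨a⟩
  exact ⟨U ⊓ V, ⟨hxU, hxV⟩, ⟨c.symm ≪≫ b⟩⟩

lemma IsLocallyTrivial.of_tensor {L M : X.Modules} (hL : IsLocallyTrivial L)
    (e : L ⊗ M ≅ unitModule X) : IsLocallyTrivial M := fun x ↦ by
  obtain ⟨U, hxU, h⟩ := hL x
  obtain ⟨c⟩ := over_tensor_iso U L M h
  exact ⟨U, hxU, ⟨c ≪≫ (SheafOfModules.overFunctor X.ringCatSheaf U).mapIso e⟩⟩

variable (X) in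
/-- The subgroup of the group of tensor-invertible isomorphism classes of `𝒪_X`-modules formed by
the classes of sheaves that are locally free of rank one. -/
noncomputable def picSubgroup : Subgroup (Skeleton X.Modules)ˣ where
  carrier := {L | IsLocallyTrivial L.1.out}
  mul_mem' {L M} hL hM := (IsLocallyTrivial.tensor hL hM).of_iso
    (Nonempty.some (Quotient.exact (Quotient.out_eq (L.1 * M.1)).symm))
  one_mem' := isLocallyTrivial_unit.of_iso
    (Nonempty.some (Quotient.exact (Quotient.out_eq (1 : Skeleton X.Modules)).symm))
  inv_mem' {L} hL := IsLocallyTrivial.of_tensor hL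
    (Nonempty.some (Quotient.exact (L.mul_inv)))

variable (X) in
/-- The Picard group of `X`: the group, under tensor product, of isomorphism classes of
invertible sheaves, that is, of `𝒪_X`-modules that are locally free of rank one. -/
def Pic : Type (u + 1) := picSubgroup X

noncomputable instance : CommGroup (Pic X) := inferInstanceAs (CommGroup (picSubgroup X))

/-- An invertible sheaf in the given class. -/
noncomputable def Pic.sheaf (L : Pic X) : X.Modules := L.1.1.out

lemma Pic.isLocallyTrivial (L : Pic X) : IsLocallyTrivial L.sheaf := L.2

/-- The isomorphism `L ⊗ L⁻¹ ≅ 𝒪_X`. -/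
noncomputable def Pic.tensorInvIso (L : Pic X) : L.sheaf ⊗ (L⁻¹).sheaf ≅ 𝟙_ X.Modules :=
  Nonempty.some (Quotient.exact (L.1.mul_inv))

/-- The isomorphism `L⁻¹ ⊗ L ≅ 𝒪_X`. -/
noncomputable def Pic.invTensorIso (L : Pic X) : (L⁻¹).sheaf ⊗ L.sheaf ≅ 𝟙_ X.Modules :=
  Nonempty.some (Quotient.exact (L.1.inv_mul))

/-- Tensoring with an invertible sheaf, as an equivalence of categories. -/
noncomputable def Pic.tensorEquiv (L : Pic X) : X.Modules ≌ X.Modules :=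
  .mk (tensorLeft L.sheaf) (tensorLeft (L⁻¹).sheaf)
    ((leftUnitorNatIso X.Modules).symm ≪≫ (curriedTensor _).mapIso L.invTensorIso.symm ≪≫
      tensorLeftTensor _ _)
    ((tensorLeftTensor _ _).symm ≪≫ (curriedTensor _).mapIso L.tensorInvIso ≪≫
      leftUnitorNatIso X.Modules)

/-- Tensoring with an invertible sheaf preserves short exact sequences. -/
lemma Pic.shortExact_tensor (L : Pic X) {T : ShortComplex X.Modules} (hT : T.ShortExact) :
    (T.map L.tensorEquiv.functor).ShortExact :=
  hT.map_of_exact L.tensorEquiv.functor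

/-- A sheaf of modules is coherent (on a locally Noetherian scheme) if it is quasi-coherent and
of finite type. -/
structure IsCoherent (M : X.Modules) : Prop where
  isQuasicoherent : SheafOfModules.IsQuasicoherent (R := X.ringCatSheaf) M
  isFiniteType : SheafOfModules.IsFiniteType (R := X.ringCatSheaf) M

lemma coversTop_of_mem {ι : Type*} (U : ι → X.Opens) (h : ∀ x, ∃ i, x ∈ U i) :
    (Opens.grothendieckTopology X).CoversTop U := by
  rw [Opens.coversTop_iff]
  exact eq_top_iff.2 fun x _ ↦ by simpa using h x

lemma isQuasicoherent_of_local {M N : X.Modules} [SheafOfModules.IsQuasicoherent (R := X.ringCatSheaf) M]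
    (h : ∀ x : X, ∃ U : X.Opens, x ∈ U ∧
      Nonempty (SheafOfModules.over M U ≅ SheafOfModules.over N U)) :
    SheafOfModules.IsQuasicoherent (R := X.ringCatSheaf) N := by
  choose U hU e using h
  have (x : X) : SheafOfModules.IsQuasicoherent (R := X.ringCatSheaf.over (U x))
      (SheafOfModules.over N (U x)) :=
    have := SheafOfModules.isQuasicoherent_over (R := X.ringCatSheaf) M (U x)
    (SheafOfModules.isQuasicoherent (X.ringCatSheaf.over (U x))).prop_of_iso (e x).some this
  exact SheafOfModules.IsQuasicoherent.of_coversTop N U (coversTop_of_mem U fun x ↦ ⟨x, hU x⟩)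

lemma isFiniteType_of_local {M N : X.Modules} [hM : SheafOfModules.IsFiniteType (R := X.ringCatSheaf) M]
    (h : ∀ x : X, ∃ U : X.Opens, x ∈ U ∧
      Nonempty (SheafOfModules.over M U ≅ SheafOfModules.over N U)) :
    SheafOfModules.IsFiniteType (R := X.ringCatSheaf) N := by
  obtain ⟨σ, hσ⟩ := hM.exists_localGeneratorsData
  choose U hU e using h
  have hc := σ.coversTop
  rw [Opens.coversTop_iff] at hc
  have (x : X) : ∃ i, x ∈ σ.X i := by
    have : x ∈ ⨆ i, σ.X i := hc ▸ trivial
    simpa using this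
  choose i hi using this
  have hle (x : X) := (over_iso_of_le (inf_le_left : U x ⊓ σ.X (i x) ≤ U x) (e x).some).some
  let G (x : X) : (SheafOfModules.over N (U x ⊓ σ.X (i x))).GeneratingSections :=
    ((σ.generators (i x)).map (SheafOfModules.overMap X.ringCatSheaf
      (homOfLE (inf_le_right : U x ⊓ σ.X (i x) ≤ σ.X (i x))))
      (SheafOfModules.overMapUnitIso _).symm).ofEpi
      ((SheafOfModules.overFunctorMap X.ringCatSheaf _).app M ≪≫ hle x).hom
  let τ : SheafOfModules.LocalGeneratorsData.{u} (R := X.ringCatSheaf) N :=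
    { I := X
      X := fun x ↦ U x ⊓ σ.X (i x)
      coversTop := coversTop_of_mem _ (fun x ↦ ⟨x, hU x, hi x⟩)
      generators := G }
  have hG (x : X) : (G x).IsFiniteType := by
    have := (hσ.isFiniteType (i x)).finite
    exact SheafOfModules.GeneratingSections.IsFiniteType.mk (σ := G x) this
  have hτ := SheafOfModules.LocalGeneratorsData.IsFiniteType.mk
    (R := X.ringCatSheaf) (M := N) (p := τ) hG
  exact SheafOfModules.IsFiniteType.mk (R := X.ringCatSheaf) (M := N) ⟨τ, hτ⟩

lemma IsCoherent.tensor {L F : X.Modules} (hL : IsLocallyTrivial L) (hF : IsCoherent F) :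
    IsCoherent (L ⊗ F) := by
  have := hF.1
  have := hF.2
  have h (x : X) : ∃ U : X.Opens, x ∈ U ∧
      Nonempty (SheafOfModules.over F U ≅ SheafOfModules.over (L ⊗ F : X.Modules) U) := by
    obtain ⟨U, hx, e⟩ := hL x
    exact ⟨U, hx, over_tensor_iso U L F e⟩
  exact ⟨isQuasicoherent_of_local h, isFiniteType_of_local h⟩

/-- The support of a sheaf of modules: the set of points with nonzero stalk. -/
def supp (M : X.Modules) : Set X := {x | Nontrivial (M.presheaf.stalk x)}

/-- The map on sections over `V ≤ U` induced by a morphism over `U`. -/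
noncomputable def overApp {M N : X.Modules} {U : X.Opens}
    (φ : SheafOfModules.over M U ⟶ SheafOfModules.over N U) (V : X.Opens) (h : V ≤ U) :
    M.presheaf.obj (op V) →+ N.presheaf.obj (op V) :=
  (φ.val.app (op (Over.mk (homOfLE h)))).hom.toAddMonoidHom

lemma overApp_res {M N : X.Modules} {U : X.Opens}
    (φ : SheafOfModules.over M U ⟶ SheafOfModules.over N U) (V W : X.Opens) (h : V ≤ U)
    (i : W ⟶ V) (s : M.presheaf.obj (op V)) :
    overApp φ W (i.le.trans h) (M.presheaf.map i.op s) = N.presheaf.map i.op (overApp φ V h s) :=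
  PresheafOfModules.naturality_apply φ.val
    (Over.homMk i : Over.mk (homOfLE (i.le.trans h)) ⟶ Over.mk (homOfLE h)).op s

lemma overApp_inv_hom {M N : X.Modules} {U : X.Opens}
    (e : SheafOfModules.over M U ≅ SheafOfModules.over N U) (V : X.Opens) (h : V ≤ U)
    (s : N.presheaf.obj (op V)) : overApp e.hom V h (overApp e.inv V h s) = s := by
  change overApp (e.inv ≫ e.hom) V h s = s
  rw [e.inv_hom_id]
  rfl

lemma mem_supp_of_over_iso {M N : X.Modules} (U : X.Opens)
    (e : SheafOfModules.over M U ≅ SheafOfModules.over N U) {x : X} (hx : x ∈ U)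
    (h : x ∈ supp N) : x ∈ supp M := by
  by_contra hM
  have hM : Subsingleton (M.presheaf.stalk x) := not_nontrivial_iff_subsingleton.1 hM
  have : Subsingleton (N.presheaf.stalk x) := by
    refine subsingleton_of_forall_eq 0 fun s ↦ ?_
    obtain ⟨V, hxV, s, rfl⟩ := TopCat.Presheaf.exists_germ_eq N.presheaf s
    -- restrict to a neighbourhood contained in `U`, and transport to `M`
    let j : V ⊓ U ⟶ V := homOfLE inf_le_left
    let t := overApp e.inv (V ⊓ U) inf_le_right (N.presheaf.map j.op s)
    have ht : M.presheaf.germ (V ⊓ U) x ⟨hxV, hx⟩ t = M.presheaf.germ (V ⊓ U) x ⟨hxV, hx⟩ 0 :=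
      Subsingleton.elim _ _
    obtain ⟨W, hxW, i, i', h₂⟩ := TopCat.Presheaf.germ_eq M.presheaf x _ _ _ _ ht
    have h₃ := overApp_res e.hom (V ⊓ U) W inf_le_right i t
    rw [h₂, overApp_inv_hom, map_zero, map_zero] at h₃
    rw [← TopCat.Presheaf.germ_res_apply N.presheaf j x ⟨hxV, hx⟩,
      ← TopCat.Presheaf.germ_res_apply N.presheaf i x hxW, ← h₃, map_zero]
  exact not_nontrivial_iff_subsingleton.2 this h

lemma supp_tensor {L F : X.Modules} (hL : IsLocallyTrivial L) : supp (L ⊗ F) = supp F := by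
  ext x
  obtain ⟨U, hx, h⟩ := hL x
  obtain ⟨e⟩ := over_tensor_iso U L F h
  exact ⟨mem_supp_of_over_iso U e hx, mem_supp_of_over_iso U e.symm hx⟩

end

section

open AlgebraicGeometry TopologicalSpace Limits
variable {X S : Scheme.{u}} (f : X ⟶ S)

/-- The support of `F` is proper over an Artin subscheme of `S`: there are a closed subscheme `Y`
of `X` whose underlying set is the support of `F` and an Artinian closed subscheme `A` of `S` such
that `f` restricts to a proper morphism `Y ⟶ A`. -/
def HasSupportProperOverArtin (F : X.Modules) : Prop :=
  ∃ (Y A : Scheme.{u}) (i : Y ⟶ X) (j : A ⟶ S) (g : Y ⟶ A), IsClosedImmersion i ∧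
    Set.range i = supp F ∧ IsClosedImmersion j ∧ IsArtinianScheme A ∧ IsProper g ∧ g ≫ j = i ≫ f

/-- The coherent sheaves on `X` whose support is proper over an Artin subscheme of `S`. -/
structure MemF (F : X.Modules) : Prop where
  isCoherent : IsCoherent F
  support : HasSupportProperOverArtin f F

lemma MemF.tensor {L F : X.Modules} (hL : IsLocallyTrivial L) (hF : MemF f F) :
    MemF f (L ⊗ F) :=
  ⟨hF.1.tensor hL, by
    have := hF.2
    unfold HasSupportProperOverArtin at this ⊢
    rwa [supp_tensor hL]⟩

/-- The type of coherent sheaves on `X` whose support is proper over an Artin subscheme of `S`. -/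
def CohF : Type (u + 1) := {F : X.Modules // MemF f F}

/-- The relations `[F₂] - [F₁] - [F₃]` for all short exact sequences
`0 ⟶ F₁ ⟶ F₂ ⟶ F₃ ⟶ 0`. -/
def relK : Set (FreeAbelianGroup (CohF f)) :=
  {x | ∃ (T : ShortComplex X.Modules) (h₁ : MemF f T.X₁) (h₂ : MemF f T.X₂) (h₃ : MemF f T.X₃),
    T.ShortExact ∧ x = .of ⟨T.X₂, h₂⟩ - .of ⟨T.X₁, h₁⟩ - .of ⟨T.X₃, h₃⟩}

/-- The Grothendieck group of the category of coherent sheaves on `X` whose support is proper over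
an Artin subscheme of `S`. -/
def GrothK : Type (u + 1) := FreeAbelianGroup (CohF f) ⧸ AddSubgroup.closure (relK f)

noncomputable instance : AddCommGroup (GrothK f) :=
  inferInstanceAs (AddCommGroup (FreeAbelianGroup (CohF f) ⧸ AddSubgroup.closure (relK f)))

/-- The class of a sheaf in the Grothendieck group. -/
noncomputable def clsK (F : CohF f) : GrothK f := QuotientAddGroup.mk (FreeAbelianGroup.of F)

/-- The subgroup `K_r` generated by the classes of the sheaves with support of dimension at most
`r`. -/
noncomputable def filK (r : ℕ) : AddSubgroup (GrothK f) :=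
  AddSubgroup.closure {x | ∃ F : CohF f, topologicalKrullDim (supp F.1) ≤ r ∧ x = clsK f F}

/-- `F ↦ L ⊗ F` on sheaves. -/
noncomputable def tensorF (L : Pic X) (F : CohF f) : CohF f :=
  ⟨L.sheaf ⊗ F.1, F.2.tensor f L.isLocallyTrivial⟩

lemma map_tensorF_relK (L : Pic X) :
    AddSubgroup.closure (relK f) ≤ (AddSubgroup.closure (relK f)).comap
      (FreeAbelianGroup.map (tensorF f L)) := by
  rw [AddSubgroup.closure_le]
  rintro _ ⟨T, h₁, h₂, h₃, hT, rfl⟩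
  refine AddSubgroup.subset_closure ⟨T.map L.tensorEquiv.functor,
    h₁.tensor f L.isLocallyTrivial, h₂.tensor f L.isLocallyTrivial,
    h₃.tensor f L.isLocallyTrivial, L.shortExact_tensor hT, ?_⟩
  have h (F : CohF f) : FreeAbelianGroup.map (tensorF f L) (.of F) = .of (tensorF f L F) :=
    FreeAbelianGroup.map_of_apply F
  rw [map_sub (FreeAbelianGroup.map (tensorF f L)), map_sub (FreeAbelianGroup.map (tensorF f L))]
  exact congrArg₂ (fun x y : FreeAbelianGroup (CohF f) ↦ x - y)
    (congrArg₂ (fun x y : FreeAbelianGroup (CohF f) ↦ x - y) (h ⟨_, h₂⟩) (h ⟨_, h₁⟩)) (h ⟨_, h₃⟩)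

/-- The action `F ↦ L ⊗ F` of an invertible sheaf on the Grothendieck group. -/
noncomputable def tensorK (L : Pic X) : AddMonoid.End (GrothK f) :=
  QuotientAddGroup.map _ _ (FreeAbelianGroup.map (tensorF f L)) (map_tensorF_relK f L)

lemma tensorK_clsK (L : Pic X) (F : CohF f) :
    tensorK f L (clsK f F) = clsK f (tensorF f L F) := by
  simp [tensorK, clsK]
  rfl

/-- The endomorphism `F ↦ F - L⁻¹ ⊗ F` of the Grothendieck group. -/
noncomputable def c₁ (L : Pic X) : AddMonoid.End (GrothK f) := 1 - tensorK f L⁻¹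

section cohomology

/-- The underlying sheaf of abelian groups of an `𝒪_X`-module. -/
noncomputable abbrev abSheaf :
    X.Modules ⥤ Sheaf (Opens.grothendieckTopology X) AddCommGrpCat.{u} :=
  SheafOfModules.toSheaf X.ringCatSheaf

/-- The cohomology groups of an `𝒪_X`-module. -/
abbrev coh (F : X.Modules) (n : ℕ) : Type u := Sheaf.H.{u} (abSheaf.obj F) n

lemma abSheaf_map_add {F G : X.Modules} (φ ψ : F ⟶ G) :
    abSheaf.map (φ + ψ) = abSheaf.map φ + abSheaf.map ψ :=
  rfl

/-- The action of the endomorphisms of `F` on its cohomology groups. -/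
noncomputable def cohAction (F : X.Modules) (n : ℕ) : End F →+* AddMonoid.End (coh F n) where
  toFun φ := Sheaf.H.map (abSheaf.map φ) n
  map_one' := by
    ext x
    change Sheaf.H.map (abSheaf.map (𝟙 F)) n x = x
    rw [abSheaf.map_id, Sheaf.H.map_id_apply]
  map_mul' φ ψ := by
    ext x
    change Sheaf.H.map (abSheaf.map (ψ ≫ φ)) n x = _
    rw [abSheaf.map_comp, Sheaf.H.map_comp_apply]
    rfl
  map_zero' := by
    ext x
    have h : abSheaf.map (0 : F ⟶ F) + abSheaf.map (0 : F ⟶ F) = abSheaf.map (0 : F ⟶ F) :=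
      (abSheaf_map_add 0 0).symm.trans (by rw [add_zero])
    have h' : abSheaf.map (0 : F ⟶ F) = 0 := by simpa using h
    have h₂ := Sheaf.H.map_add_apply (0 : abSheaf.obj F ⟶ abSheaf.obj F) 0 (n := n) x
    rw [add_zero] at h₂
    change Sheaf.H.map (abSheaf.map (0 : F ⟶ F)) n x = 0
    rw [h']
    simpa using h₂
  map_add' φ ψ := by
    ext x
    change Sheaf.H.map (abSheaf.map (φ + ψ)) n x = _
    rw [abSheaf_map_add]
    exact Sheaf.H.map_add_apply ..

lemma map_app_res {V W : S.Opens} (i : W ⟶ V) (a : Γ(S, V)) {U : X.Opens} (h : U ≤ f ⁻¹ᵁ W) :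
    X.presheaf.map (homOfLE h).op (f.app W (S.presheaf.map i.op a)) =
      X.presheaf.map (homOfLE (h.trans (f.preimage_mono i.le))).op (f.app V a) := by
  have := congrArg (fun φ ↦ φ a) (f.naturality i.op)
  simp only [CommRingCat.comp_apply] at this
  rw [this, ← CommRingCat.comp_apply, ← Functor.map_comp]
  rfl

/-- The ring of functions on `S` acting on `F`: the endomorphisms of `F` that are given, locally
on `S`, by multiplication by a function on `S`. If the support of `F` is proper over an Artin
subscheme of `S`, this is the (Artinian) ring of functions on the smallest closed subscheme `A` of
`S` such that `F` is a module over `𝒪_A`. -/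
noncomputable def baseFunctions (F : X.Modules) : Subring (End F) where
  carrier := {φ | ∀ s : S, ∃ (V : S.Opens) (_ : s ∈ V) (a : Γ(S, V)),
    ∀ (U : X.Opens) (h : U ≤ f ⁻¹ᵁ V) (m : F.presheaf.obj (op U)),
      Scheme.Modules.Hom.app φ U m = X.presheaf.map (homOfLE h).op (f.app V a) • m}
  mul_mem' {φ ψ} hφ hψ s := by
    obtain ⟨V, hs, a, ha⟩ := hφ s
    obtain ⟨W, hs', b, hb⟩ := hψ s
    refine ⟨V ⊓ W, ⟨hs, hs'⟩, S.presheaf.map (homOfLE inf_le_left).op a *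
      S.presheaf.map (homOfLE inf_le_right).op b, fun U h m ↦ ?_⟩
    change Scheme.Modules.Hom.app φ U (Scheme.Modules.Hom.app ψ U m) = _
    rw [hb U (h.trans (f.preimage_mono inf_le_right)),
      ha U (h.trans (f.preimage_mono inf_le_left)), smul_smul, map_mul, map_mul,
      map_app_res, map_app_res]
  one_mem' s := ⟨⊤, trivial, 1, fun U h m ↦ by
    rw [map_one, map_one, one_smul]; rfl⟩
  add_mem' {φ ψ} hφ hψ s := by
    obtain ⟨V, hs, a, ha⟩ := hφ s
    obtain ⟨W, hs', b, hb⟩ := hψ s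
    refine ⟨V ⊓ W, ⟨hs, hs'⟩, S.presheaf.map (homOfLE inf_le_left).op a +
      S.presheaf.map (homOfLE inf_le_right).op b, fun U h m ↦ ?_⟩
    change Scheme.Modules.Hom.app φ U m + Scheme.Modules.Hom.app ψ U m = _
    rw [hb U (h.trans (f.preimage_mono inf_le_right)),
      ha U (h.trans (f.preimage_mono inf_le_left)), map_add, map_add, add_smul,
      map_app_res, map_app_res]
  zero_mem' s := ⟨⊤, trivial, 0, fun U h m ↦ by
    rw [map_zero, map_zero, zero_smul]; rfl⟩
  neg_mem' {φ} hφ s := by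
    obtain ⟨V, hs, a, ha⟩ := hφ s
    refine ⟨V, hs, -a, fun U h m ↦ ?_⟩
    change -Scheme.Modules.Hom.app φ U m = _
    rw [ha U h, map_neg, map_neg, neg_smul]

/-- The length of the `n`-th cohomology group of `F`, as a module over the functions on the base. -/
noncomputable def cohLength (F : X.Modules) (n : ℕ) : ℕ∞ :=
  letI : Module (baseFunctions f F) (coh F n) :=
    Module.compHom _ ((cohAction F n).comp (baseFunctions f F).subtype)
  Module.length (baseFunctions f F) (coh F n)

/-- The Euler characteristic of a sheaf: the alternating sum of the lengths of its cohomology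
groups. -/
noncomputable def eulerChar (F : X.Modules) : ℤ :=
  ∑ᶠ n : ℕ, (-1) ^ n * ((cohLength f F n).toNat : ℤ)

end cohomology

/-- The homomorphism from the Grothendieck group to `ℤ` induced by the Euler characteristic: the
homomorphism with `χ [F] = eulerChar F` for every coherent sheaf `F` with support proper over an
Artin subscheme. It is unique, since these classes generate the group. It exists when `S` is locally
Noetherian and `f` is separated of finite type: then the lengths are finite, and the Euler
characteristic is additive on short exact sequences. -/
noncomputable def χ : GrothK f →+ ℤ :=
  Classical.epsilon fun φ : GrothK f →+ ℤ ↦ ∀ F : CohF f, φ (clsK f F) = eulerChar f F.1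

/-- The homomorphism `χ` is the only one that extends the Euler characteristic of sheaves. -/
lemma χ_eq (φ : GrothK f →+ ℤ) (hφ : ∀ F : CohF f, φ (clsK f F) = eulerChar f F.1) : χ f = φ := by
  have h : ∀ F : CohF f, χ f (clsK f F) = eulerChar f F.1 :=
    Classical.epsilon_spec
      (p := fun φ : GrothK f →+ ℤ ↦ ∀ F : CohF f, φ (clsK f F) = eulerChar f F.1) ⟨φ, hφ⟩
  refine QuotientAddGroup.addMonoidHom_ext _ (FreeAbelianGroup.lift_ext _ _ fun F ↦ ?_)
  exact (h F).trans (hφ F).symm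

end

end Snapper

/-!
The Euler characteristic enters only as a homomorphism from the Grothendieck group `K` to `ℤ`, so
the formula is proved in `K` itself, and `χ` is applied at the end.

The heart of the matter is that `c₁ L` lowers the filtration of `K` by the dimension of the support
(`c₁_mem_filLT`): if `F` has support of dimension at most `k`, then the class `F - L ⊗ F` is a
combination of classes of sheaves with support of dimension less than `k`, for every invertible
sheaf `L`. The support of `F` is a Noetherian space, so Noetherian induction applies. If the support
is contained in a union `Z₁ ∪ Z₂` of closed sets, neither of which contains it, then `F` has a
subsheaf with support in `Z₂` whose quotient has support in `Z₁` (`exists_devissage`), and both have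
smaller support than `F`. If the support is irreducible, choose an open subset `U` that meets it and
over which `L` is trivial, and hence an isomorphism `φ` of `F` with `E = L ⊗ F` over `U`. The
sections of `F ⊞ E` that lie over `U` on the graph of `φ` form a sheaf `G` that maps to `F` and to
`E`, and both maps are isomorphisms over `U`. So `F` and `E` have the class of `G` up to classes of
sheaves with support off `U`, and these have smaller dimension (`clsK_sub_mem_of_iso`). All of this
needs kernels of maps from a coherent sheaf to `ι_* ι^* E` to be coherent, where `ι` is the
inclusion of `U`; quasi-coherence of `ι_* ι^* E` is not required for that, but only that its
sections which vanish on `D(f)` are killed by a power of `f` (`IsCoherent.kernel_of_torsion`,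
`restrictExtend_torsion`).

Consequently a product of more than `r` operators `c₁ L` kills `K_r`. On `K_r` the operator `L ⊗ -`
is the inverse of `1 - c₁ L`, with `c₁ L` nilpotent, and the formula is the binomial expansion of
`(1 - c₁ L) ^ (-m)` (`zpow_smul_eq_sum`), iterated over the sheaves `L₁, …, Lₙ`
(`map_prod_zpow_apply_eq_sum_filter`). Each term is a constant times a polynomial in the exponents
`m` of total degree `∑ j, i j ≤ r` (`eval_multichoosePoly`).
-/

namespace Snapper
open AlgebraicGeometry TopologicalSpace Limits

/-! ### Sections and supports of sheaves of modules -/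

section sections
variable {X : Scheme.{u}}

/-- The functor of sections over an open subset, with values in abelian groups. -/
noncomputable def sectionsFunctor (U : X.Opens) : X.Modules ⥤ Ab.{u} :=
  Scheme.Modules.toPresheaf X ⋙ (evaluation _ _).obj (op U)

noncomputable instance (U : X.Opens) : PreservesLimits (sectionsFunctor U) :=
  have : PreservesLimits ((evaluation X.Opensᵒᵖ Ab.{u}).obj (op U)) := inferInstance
  comp_preservesLimits (Scheme.Modules.toPresheaf X) ((evaluation X.Opensᵒᵖ Ab.{u}).obj (op U))

instance (U : X.Opens) : (sectionsFunctor U).Additive where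
  map_add := rfl

lemma injective_app_of_mono {M N : X.Modules} (φ : M ⟶ N) [Mono φ] (U : X.Opens) :
    Function.Injective (φ.app U) :=
  (AddCommGrpCat.mono_iff_injective _).1 (inferInstanceAs (Mono ((sectionsFunctor U).map φ)))

lemma kernel_ι_app_apply {M N : X.Modules} (φ : M ⟶ N) (U : X.Opens)
    (k : Γ(kernel φ, U)) : φ.app U ((kernel.ι φ).app U k) = 0 := by
  rw [← ConcreteCategory.comp_apply, ← Scheme.Modules.Hom.comp_app, kernel.condition]
  rfl

lemma exists_kernel_ι_app_eq {M N : X.Modules} (φ : M ⟶ N) (U : X.Opens) (s : Γ(M, U))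
    (hs : φ.app U s = 0) : ∃ k : Γ(kernel φ, U), (kernel.ι φ).app U k = s := by
  let T : ShortComplex X.Modules := ShortComplex.mk _ _ (kernel.condition φ)
  have hT : T.Exact := ShortComplex.exact_kernel φ
  have : Mono T.f := inferInstanceAs (Mono (kernel.ι φ))
  have h := (hT.map_of_mono_of_preservesKernel (sectionsFunctor U) inferInstance inferInstance)
  rw [ShortComplex.ab_exact_iff] at h
  exact h s hs

lemma hom_app_res {M N : X.Modules} (φ : M ⟶ N) {U V : X.Opens} (i : U ⟶ V) (s : Γ(M, V)) :
    φ.app U (M.presheaf.map i.op s) = N.presheaf.map i.op (φ.app V s) :=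
  congr($(φ.mapPresheaf.naturality i.op) s)

/-- The support of `M` avoids `W` exactly when `M` has no nonzero sections over the open subsets
of `W`. -/
lemma disjoint_supp_iff {M : X.Modules} {W : X.Opens} :
    Disjoint (W : Set X) (supp M) ↔ ∀ V ≤ W, ∀ s : Γ(M, V), s = 0 := by
  constructor
  · intro h V hV s
    refine TopCat.Presheaf.section_ext ⟨_, M.isSheaf⟩ V s 0 fun x hx ↦ ?_
    have : Subsingleton (M.presheaf.stalk x) :=
      not_nontrivial_iff_subsingleton.1 fun hx' ↦ Set.disjoint_left.1 h (hV hx) hx'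
    exact Subsingleton.elim (α := M.presheaf.stalk x) _ _
  · intro h
    refine Set.disjoint_left.2 fun x hx hx' ↦ not_nontrivial_iff_subsingleton.2 ?_ hx'
    refine subsingleton_of_forall_eq 0 fun s ↦ ?_
    obtain ⟨V, hxV, s, rfl⟩ := TopCat.Presheaf.exists_germ_eq M.presheaf s
    rw [← TopCat.Presheaf.germ_res_apply M.presheaf (homOfLE (inf_le_left : V ⊓ W ≤ V)) x ⟨hxV, hx⟩,
      h _ inf_le_right (M.presheaf.map _ s), map_zero]

lemma isZero_of_supp_eq_empty {M : X.Modules} (h : supp M = ∅) : IsZero M := by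
  rw [IsZero.iff_id_eq_zero]
  ext U s
  exact (disjoint_supp_iff (W := ⊤)).1 (by simp [h]) U le_top _

end sections

/-! ### Sheaves associated with finite modules on an affine scheme -/

section spec
variable {R : CommRingCat.{u}}

/-- A sheaf of modules on `Spec R` associated with a finite `R`-module. -/
def IsFiniteTilde (M : (Spec R).Modules) : Prop :=
  ∃ N : ModuleCat.{u} R, Module.Finite R N ∧ Nonempty (tilde N ≅ M)

lemma IsFiniteTilde.of_iso {M M' : (Spec R).Modules} (h : IsFiniteTilde M) (e : M ≅ M') :
    IsFiniteTilde M' := by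
  obtain ⟨N, hN, ⟨i⟩⟩ := h
  exact ⟨N, hN, ⟨i ≪≫ e⟩⟩

lemma IsFiniteTilde.isIso_fromTildeΓ {M : (Spec R).Modules} (h : IsFiniteTilde M) :
    IsIso M.fromTildeΓ := by
  obtain ⟨N, hN, ⟨i⟩⟩ := h
  exact isIso_fromTildeΓ_iff.2 ⟨N, ⟨i⟩⟩

lemma isFiniteTilde_iff (M : (Spec R).Modules) :
    IsFiniteTilde M ↔ IsIso M.fromTildeΓ ∧ Module.Finite R Γ(M, ⊤) := by
  constructor
  · intro h
    refine ⟨h.isIso_fromTildeΓ, ?_⟩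
    obtain ⟨N, hN, ⟨i⟩⟩ := h
    let e : N ≅ (moduleSpecΓFunctor).obj M := tilde.isoTop N ≪≫ moduleSpecΓFunctor.mapIso i
    exact Module.Finite.equiv e.toLinearEquiv
  · rintro ⟨h, h'⟩
    exact ⟨_, h', ⟨asIso M.fromTildeΓ⟩⟩

lemma IsFiniteTilde.cokernel {M N : (Spec R).Modules} (hM : IsFiniteTilde M)
    (hN : IsFiniteTilde N) (φ : M ⟶ N) : IsFiniteTilde (cokernel φ) := by
  obtain ⟨A, hA, ⟨i⟩⟩ := hM
  obtain ⟨B, hB, ⟨j⟩⟩ := hN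
  let g : A ⟶ B := (tilde.functor R).preimage (i.hom ≫ φ ≫ j.inv)
  have hg : (tilde.functor R).map g ≫ j.hom = i.hom ≫ φ := by
    have h : tilde.map g = i.hom ≫ φ ≫ j.inv := (tilde.functor R).map_preimage _
    change tilde.map g ≫ j.hom = _
    simp [h]
  refine ⟨Limits.cokernel g, ?_, ⟨PreservesCokernel.iso (tilde.functor R) g ≪≫
    cokernel.mapIso _ _ i j hg⟩⟩
  exact Module.Finite.of_surjective (cokernel.π g).hom
    ((ModuleCat.epi_iff_surjective _).1 inferInstance)

lemma IsFiniteTilde.biprod {M N : (Spec R).Modules} (hM : IsFiniteTilde M)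
    (hN : IsFiniteTilde N) : IsFiniteTilde (M ⊞ N) := by
  obtain ⟨A, hA, ⟨i⟩⟩ := hM
  obtain ⟨B, hB, ⟨j⟩⟩ := hN
  have := preservesBinaryBiproducts_of_preservesBinaryCoproducts (tilde.functor R)
  refine ⟨A ⊞ B, Module.Finite.equiv (ModuleCat.biprodIsoProd A B).symm.toLinearEquiv,
    ⟨(tilde.functor R).mapBiprod A B ≪≫ biprod.mapIso i j⟩⟩

/-- The basic open subset of `Spec R` defined by `f`. -/
def specBasicOpen (f : R) : (Spec R).Opens := PrimeSpectrum.basicOpen f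

/-- A sheaf of modules on `Spec R` is quasi-coherent when its sections over `D(f)` are the
localizations at `f` of its global sections, here in terms of elements. -/
lemma isIso_fromTildeΓ_iff_forall (M : (Spec R).Modules) :
    IsIso M.fromTildeΓ ↔ ∀ f : R,
      (∀ x : Γ(M, specBasicOpen f), ∃ (n : ℕ) (y : Γ(M, ⊤)),
        f ^ n • x = M.presheaf.map (specBasicOpen f).leTop.op y) ∧
      (∀ x : Γ(M, ⊤), M.presheaf.map (specBasicOpen f).leTop.op x = 0 →
        ∃ n : ℕ, f ^ n • x = 0) := by
  rw [isIso_fromTildeΓ_iff_isLocalizing]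
  refine forall_congr' fun f ↦ ?_
  let ρ : Γ(M, ⊤) →ₗ[R] Γ(M, specBasicOpen f) :=
    ((modulesSpecToSheaf.obj M).obj.map (specBasicOpen f).leTop.op).hom
  have hρ (x) : ρ x = M.presheaf.map (specBasicOpen f).leTop.op x := rfl
  change IsLocalizedModule (.powers f) ρ ↔ _
  simp only [← hρ]
  refine ⟨fun h ↦ ⟨fun x ↦ ?_, fun x hx ↦ ?_⟩, fun ⟨h₁, h₂⟩ ↦ ?_⟩
  · obtain ⟨⟨y, ⟨_, n, rfl⟩⟩, hy⟩ := h.surj x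
    exact ⟨n, y, hy⟩
  · obtain ⟨⟨_, n, rfl⟩, hn⟩ := (IsLocalizedModule.eq_zero_iff (.powers f) ρ).1 hx
    exact ⟨n, hn⟩
  · refine IsLocalizedModule.Away.mk_of_addCommGroup ?_ h₁ h₂
    exact Scheme.Modules.isUnit_algebraMap_end_of_le_basicOpen f le_rfl

lemma app_smul_spec {M N : (Spec R).Modules} (φ : M ⟶ N) (U : (Spec R).Opens) (r : R)
    (s : Γ(M, U)) : φ.app U (r • s) = r • φ.app U s := by
  rw [Scheme.Modules.smul_Spec_def, Scheme.Modules.smul_Spec_def, φ.app_smul]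

/-- The kernel of a morphism from a quasi-coherent sheaf is quasi-coherent as soon as each section
of the target that vanishes on `D(f)` is killed by a power of `f`. The target itself need not be
quasi-coherent. -/
lemma isIso_fromTildeΓ_of_exact {K M Q : (Spec R).Modules} [IsIso M.fromTildeΓ] (k : K ⟶ M)
    (ψ : M ⟶ Q) (hk : ∀ U, Function.Injective (k.app U))
    (hψ : ∀ U (s : Γ(M, U)), ψ.app U s = 0 ↔ ∃ t, k.app U t = s)
    (hQ : ∀ (f : R) (t : Γ(Q, ⊤)), Q.presheaf.map (specBasicOpen f).leTop.op t = 0 →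
      ∃ n : ℕ, f ^ n • t = 0) :
    IsIso K.fromTildeΓ := by
  have hM := (isIso_fromTildeΓ_iff_forall M).1 inferInstance
  refine (isIso_fromTildeΓ_iff_forall K).2 fun f ↦ ⟨fun x ↦ ?_, fun x hx ↦ ?_⟩
  · obtain ⟨n, y, hy⟩ := (hM f).1 (k.app _ x)
    obtain ⟨m, hm⟩ := hQ f (ψ.app ⊤ y) (by
      rw [← hom_app_res, ← hy, app_smul_spec, (hψ _ _).2 ⟨x, rfl⟩, smul_zero])
    rw [← app_smul_spec] at hm
    obtain ⟨z, hz⟩ := (hψ _ _).1 hm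
    refine ⟨m + n, z, hk _ ?_⟩
    rw [hom_app_res, hz, app_smul_spec, pow_add, mul_smul, hy, Scheme.Modules.map_smul_Spec]
  · obtain ⟨n, hn⟩ := (hM f).2 (k.app ⊤ x) (by rw [← hom_app_res, hx, map_zero])
    refine ⟨n, hk _ ?_⟩
    rw [app_smul_spec, map_zero, hn]

lemma IsFiniteTilde.of_exact [IsNoetherianRing R] {K M Q : (Spec R).Modules}
    (hM : IsFiniteTilde M) (k : K ⟶ M)
    (ψ : M ⟶ Q) (hk : ∀ U, Function.Injective (k.app U))
    (hψ : ∀ U (s : Γ(M, U)), ψ.app U s = 0 ↔ ∃ t, k.app U t = s)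
    (hQ : ∀ (f : R) (t : Γ(Q, ⊤)), Q.presheaf.map (specBasicOpen f).leTop.op t = 0 →
      ∃ n : ℕ, f ^ n • t = 0) :
    IsFiniteTilde K := by
  rw [isFiniteTilde_iff] at hM ⊢
  have := hM.1
  refine ⟨isIso_fromTildeΓ_of_exact k ψ hk hψ hQ, ?_⟩
  have : Module.Finite R (moduleSpecΓFunctor.obj M) := hM.2
  exact Module.Finite.of_injective (moduleSpecΓFunctor.map k).hom (hk ⊤)

end spec

/-! ### Coherent sheaves restricted to affine open subsets -/

section coherent

/-- A quasi-coherent quotient of a sheaf associated with a finite module is of the same kind. -/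
lemma IsFiniteTilde.of_epi {R : CommRingCat.{u}} {M F : (Spec R).Modules}
    [IsIso M.fromTildeΓ] (hF : IsFiniteTilde F) (π : F ⟶ M) [Epi π] : IsFiniteTilde M := by
  obtain ⟨A, hA, ⟨i⟩⟩ := hF
  let N := (modulesSpecToSheaf.obj M).presheaf.obj (.op ⊤)
  let e : tilde N ≅ M := asIso M.fromTildeΓ
  let q : (tilde.functor R).obj A ⟶ (tilde.functor R).obj N := i.hom ≫ π ≫ e.inv
  have hq : Epi q := by
    have h₁ : Epi (π ≫ e.inv) := epi_comp _ _
    exact epi_comp i.hom (π ≫ e.inv)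
  obtain ⟨g, hg⟩ := (tilde.functor R).map_surjective q
  have hg : Epi g := (tilde.functor R).epi_of_epi_map (by rw [hg]; exact hq)
  exact ⟨N, Module.Finite.of_surjective g.hom ((ModuleCat.epi_iff_surjective _).1 hg), ⟨e⟩⟩

lemma IsFiniteTilde.of_generatingSections {R : CommRingCat.{u}} (M : (Spec R).Modules)
    [IsIso M.fromTildeΓ] (G : SheafOfModules.GeneratingSections (R := (Spec R).ringCatSheaf) M)
    [G.IsFiniteType] : IsFiniteTilde M := by
  have : Finite G.I := SheafOfModules.GeneratingSections.IsFiniteType.finite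
  let F : (Spec R).Modules := SheafOfModules.free G.I
  let π : F ⟶ M := G.π
  have hπ : Epi π := G.epi
  have hF : IsFiniteTilde F :=
    ⟨ModuleCat.of R (G.I →₀ R), inferInstanceAs (Module.Finite R (G.I →₀ R)), ⟨tildeFinsupp G.I⟩⟩
  exact hF.of_epi π

lemma image_top_eq_specBasicOpen {R S : CommRingCat.{u}} (φ : R ⟶ S) [IsOpenImmersion (Spec.map φ)]
    (f : R) (hφ : letI := φ.hom.toAlgebra; IsLocalization.Away f S) :
    Spec.map φ ''ᵁ ⊤ = specBasicOpen f := by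
  let := φ.hom.toAlgebra
  ext1
  have := PrimeSpectrum.localization_away_comap_range S f
  rw [Scheme.Hom.image_top_eq_opensRange]
  exact this

/-- Finiteness of a quasi-coherent sheaf can be checked on a cover by basic open subsets. -/
lemma IsFiniteTilde.of_away {R : CommRingCat.{u}} (M : (Spec R).Modules) [hM : IsIso M.fromTildeΓ]
    (t : Set R) (ht : Ideal.span t = ⊤) (S : t → CommRingCat.{u}) (φ : ∀ f, R ⟶ S f)
    [∀ f, IsOpenImmersion (Spec.map (φ f))]
    (hφ : ∀ f, letI := (φ f).hom.toAlgebra; IsLocalization.Away f.1 (S f))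
    (h : ∀ f : t, IsFiniteTilde (M.restrict (Spec.map (φ f)))) :
    IsFiniteTilde M := by
  rw [isFiniteTilde_iff]
  refine ⟨hM, ?_⟩
  let (f : t) : Algebra R (S f) := (φ f).hom.toAlgebra
  let (f : t) : Module R Γ(M.restrict (Spec.map (φ f)), ⊤) := Module.compHom _ (φ f).hom
  have (f : t) : IsScalarTower R (S f) Γ(M.restrict (Spec.map (φ f)), ⊤) :=
    .of_algebraMap_smul fun _ _ ↦ rfl
  let e (f : t) := M.restrictAppIso (Spec.map (φ f)) ⊤
  have he (f : t) : Function.Injective (e f).hom :=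
    (ConcreteCategory.bijective_of_isIso (e f).hom).1
  have hsmul (f : t) (r : R) (x : Γ(M.restrict (Spec.map (φ f)), ⊤)) :
      (e f).hom (r • x) = r • (e f).hom x :=
    Scheme.Modules.restrictAppIso_smul_Spec (φ f) r x
  let ρ (f : t) : Γ(M, ⊤) →ₗ[R] Γ(M.restrict (Spec.map (φ f)), ⊤) :=
    { toFun x := (e f).inv (M.presheaf.map (Opens.leTop _).op x)
      map_add' x y := by simp
      map_smul' r x := by
        apply he
        simp [hsmul] }
  have hρ (f : t) : IsLocalizedModule.Away f.1 (ρ f) := by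
    have key := (isIso_fromTildeΓ_iff_forall M).1 hM f.1
    rw [← image_top_eq_specBasicOpen (φ f) f.1 (hφ f)] at key
    refine IsLocalizedModule.Away.mk_of_addCommGroup ?_ (fun x ↦ ?_) (fun x hx ↦ ?_)
    · have := (IsLocalization.Away.algebraMap_isUnit (S := S f) f.1).map
        (algebraMap (S f) (Module.End (S f) Γ(M.restrict (Spec.map (φ f)), ⊤)))
      rw [Module.End.isUnit_iff] at this ⊢
      exact this
    · obtain ⟨n, y, hy⟩ := key.1 ((e f).hom x)
      exact ⟨n, y, he f (by rw [hsmul, hy]; simp [ρ])⟩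
    · refine key.2 x ?_
      have := congr((e f).hom $hx)
      simpa [ρ] using this
  exact Module.Finite.of_localizationSpan' t ht ρ fun f ↦ ((isFiniteTilde_iff _).1 (h f)).2

lemma exists_mem_specBasicOpen {R : CommRingCat.{u}} (p : Spec R) (U : (Spec R).Opens)
    (hp : p ∈ U) : ∃ f : R, p ∈ specBasicOpen f ∧ specBasicOpen f ≤ U := by
  obtain ⟨_, ⟨f, rfl⟩, hpf, hf⟩ :=
    PrimeSpectrum.isTopologicalBasis_basic_opens.exists_subset_of_mem_open hp U.2
  exact ⟨f, hpf, hf⟩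

/-- The restriction of `M` along an open immersion that factors through an open subset `W` is
the restriction of the sheaf over `W` that `M` determines. -/
noncomputable def overCompIso {X Y : Scheme.{u}} (W : X.Opens) (l : Y ⟶ W) [IsOpenImmersion l]
    (k : Y ⟶ X) [IsOpenImmersion k] (hk : l ≫ W.ι = k) (M : X.Modules) :
    ((Scheme.Modules.overEquiv W).functor ⋙ Scheme.Modules.restrictFunctor l).obj
      (SheafOfModules.over M W) ≅ M.restrict k :=
  (Scheme.Modules.restrictFunctor l).mapIso ((Scheme.Modules.overFunctorEquiv W).app M) ≪≫
    (Scheme.Modules.restrictFunctorComp l W.ι).symm.app M ≪≫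
    (Scheme.Modules.restrictFunctorCongr hk).app M

lemma isFiniteTilde_restrict_of_generatingSections {X : Scheme.{u}} {M : X.Modules}
    [SheafOfModules.IsQuasicoherent (R := X.ringCatSheaf) M] {R : CommRingCat.{u}} (k : Spec R ⟶ X)
    [IsOpenImmersion k] (W : X.Opens) (hk : Set.range k ⊆ W)
    (σ : (SheafOfModules.over M W).GeneratingSections) [hσ : σ.IsFiniteType] :
    IsFiniteTilde (M.restrict k) := by
  let l := IsOpenImmersion.lift W.ι k (by rwa [Scheme.Opens.range_ι])
  have hl : l ≫ W.ι = k := IsOpenImmersion.lift_fac _ _ _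
  have : IsOpenImmersion l := by
    have : IsOpenImmersion (l ≫ W.ι) := by rw [hl]; infer_instance
    exact .of_comp l W.ι
  have h₁ : PreservesColimitsOfSize.{u, u} (Scheme.Modules.overEquiv W).functor := inferInstance
  have h₂ : PreservesColimitsOfSize.{u, u} (Scheme.Modules.restrictFunctor l) := inferInstance
  let F : SheafOfModules.{u} (X.ringCatSheaf.over W) ⥤ SheafOfModules.{u} (Spec R).ringCatSheaf :=
    (Scheme.Modules.overEquiv W).functor ⋙ Scheme.Modules.restrictFunctor l
  have h₃ : PreservesColimitsOfSize.{u, u} F :=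
    comp_preservesColimits (Scheme.Modules.overEquiv W).functor (Scheme.Modules.restrictFunctor l)
  let e : F.obj (SheafOfModules.over M W) ⟶ M.restrict k := (overCompIso W l k hl M).hom
  have he : Epi e := inferInstanceAs (Epi (overCompIso W l k hl M).hom)
  let G := (σ.map F (Scheme.Modules.restrictUnitIso l).symm).ofEpi e
  have : G.IsFiniteType := .mk (inferInstanceAs (Finite σ.I))
  exact .of_generatingSections _ G

/-- Over an affine open subset, a coherent sheaf is associated with a finite module. -/
lemma IsCoherent.isFiniteTilde_restrict {X : Scheme.{u}} {M : X.Modules} (hM : IsCoherent M)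
    {R : CommRingCat.{u}} (j : Spec R ⟶ X) [IsOpenImmersion j] : IsFiniteTilde (M.restrict j) := by
  obtain ⟨σ, hσ⟩ := hM.2.exists_localGeneratorsData
  have : SheafOfModules.IsQuasicoherent (R := X.ringCatSheaf) M := hM.1
  have hc := σ.coversTop
  rw [Opens.coversTop_iff] at hc
  let t : Set R := {f | ∃ i, specBasicOpen f ≤ j ⁻¹ᵁ σ.X i}
  have ht : Ideal.span t = ⊤ := by
    rw [← PrimeSpectrum.iSup_basicOpen_eq_top_iff', eq_top_iff]
    intro p _
    have hp : j p ∈ ⨆ i, σ.X i := hc ▸ trivial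
    obtain ⟨i, hi⟩ := Opens.mem_iSup.1 hp
    obtain ⟨f, hpf, hf⟩ := exists_mem_specBasicOpen p (j ⁻¹ᵁ σ.X i) hi
    simp only [Opens.mem_iSup]
    exact ⟨f, ⟨i, hf⟩, hpf⟩
  let φ (f : t) : R ⟶ CommRingCat.of (Localization.Away f.1) := CommRingCat.ofHom (algebraMap R _)
  have hφ (f : t) :
      letI := (φ f).hom.toAlgebra; IsLocalization.Away f.1 (Localization.Away f.1) := by
    have h : (φ f).hom.toAlgebra = (inferInstance : Algebra R (Localization.Away f.1)) :=
      Algebra.algebra_ext _ _ fun _ ↦ rfl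
    rw [h]
    infer_instance
  have hopen (f : t) : IsOpenImmersion (Spec.map (φ f)) :=
    inferInstanceAs (IsOpenImmersion (Spec.map (CommRingCat.ofHom (algebraMap R _))))
  refine IsFiniteTilde.of_away _ t ht _ φ hφ fun f ↦ ?_
  obtain ⟨i, hi⟩ := f.2
  have := hσ.isFiniteType i
  have e := (Scheme.Modules.restrictFunctorComp (Spec.map (φ f)) j).app M
  refine (isFiniteTilde_restrict_of_generatingSections (M := M) (Spec.map (φ f) ≫ j) (σ.X i) ?_
    (σ.generators i)).of_iso e
  rintro _ ⟨p, rfl⟩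
  refine hi ?_
  rw [← image_top_eq_specBasicOpen (φ f) f.1 (hφ f)]
  exact ⟨p, trivial, rfl⟩

end coherent

/-! ### Kernels and cokernels of coherent sheaves -/

section coherent

lemma exists_finite_presentation_tilde {R : CommRingCat.{u}} [IsNoetherianRing R]
    (N : ModuleCat.{u} R) [hN : Module.Finite R N] :
    ∃ P : SheafOfModules.Presentation (R := (Spec R).ringCatSheaf) (tilde N), P.IsFinite := by
  obtain ⟨s, hs⟩ := hN.1
  have hker : (LinearMap.ker
      (Finsupp.linearCombination R (Subtype.val : ((s : Set N) : Type u) → N))).FG :=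
    IsNoetherian.noetherian _
  obtain ⟨t, ht⟩ := hker
  exact ⟨presentationTilde N s hs t ht, .mk (.mk (inferInstanceAs (Finite s)))
    (.mk (inferInstanceAs (Finite t)))⟩

/-- A presentation of the module that defines `M` on an affine open subset gives a presentation
of `M` over the image of that subset. -/
lemma exists_finite_presentation_over {X : Scheme.{u}} {M : X.Modules} {R : CommRingCat.{u}}
    [IsNoetherianRing R] (j : Spec R ⟶ X) [IsOpenImmersion j] (h : IsFiniteTilde (M.restrict j)) :
    ∃ P : (SheafOfModules.over M j.opensRange).Presentation, P.IsFinite := by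
  obtain ⟨N, hN, ⟨i⟩⟩ := h
  obtain ⟨P, hP⟩ := exists_finite_presentation_tilde N
  let W := j.opensRange
  let l : (W : Scheme.{u}) ⟶ Spec R := j.isoOpensRange.inv
  have hl : l ≫ j = W.ι := j.isoOpensRange_inv_comp
  have h₁ : PreservesColimitsOfSize.{u, u} (Scheme.Modules.overEquiv W).inverse := inferInstance
  have h₂ : PreservesColimitsOfSize.{u, u} (Scheme.Modules.restrictFunctor l) := inferInstance
  let F : SheafOfModules.{u} (Spec R).ringCatSheaf ⥤ SheafOfModules.{u} (X.ringCatSheaf.over W) :=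
    Scheme.Modules.restrictFunctor l ⋙ (Scheme.Modules.overEquiv W).inverse
  have h₃ : PreservesColimitsOfSize.{u, u} F :=
    comp_preservesColimits (Scheme.Modules.restrictFunctor l) (Scheme.Modules.overEquiv W).inverse
  -- the restriction of `M` to `W`, computed in two ways
  let e₁ : (Scheme.Modules.restrictFunctor l).obj (tilde N) ≅ M.restrict W.ι :=
    (Scheme.Modules.restrictFunctor l).mapIso i ≪≫
    (Scheme.Modules.restrictFunctorComp l j).symm.app M ≪≫
    (Scheme.Modules.restrictFunctorCongr hl).app M
  let e : F.obj (tilde N) ≅ SheafOfModules.over M W :=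
    (Scheme.Modules.overEquiv W).inverse.mapIso
      (e₁ ≪≫ ((Scheme.Modules.overFunctorEquiv W).app M).symm) ≪≫
    ((Scheme.Modules.overEquiv W).unitIso.app (SheafOfModules.over M W)).symm
  let η : SheafOfModules.unit (X.ringCatSheaf.over W) ≅
      F.obj (SheafOfModules.unit (Spec R).ringCatSheaf) :=
    (Scheme.Modules.overEquiv W).unitIso.app (SheafOfModules.unit (X.ringCatSheaf.over W)) ≪≫
    (Scheme.Modules.overEquiv W).inverse.mapIso
      ((Scheme.Modules.overFunctorEquiv W).app (unitModule X) ≪≫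
        Scheme.Modules.restrictUnitIso W.ι ≪≫ (Scheme.Modules.restrictUnitIso l).symm)
  have hg : Finite P.generators.I := hP.isFiniteType_generators.finite
  have hr : Finite P.relations.I := hP.isFiniteType_relations.finite
  exact ⟨(P.map F η).ofIsIso e.hom, .mk (.mk (inferInstanceAs (Finite P.generators.I)))
    (.mk (inferInstanceAs (Finite P.relations.I)))⟩

lemma isCoherent_of_isFinitePresentation {X : Scheme.{u}}
    (M : SheafOfModules.{u} X.ringCatSheaf) (h : M.IsFinitePresentation) :
    IsCoherent (show X.Modules from M) :=
  ⟨(inferInstance : M.IsQuasicoherent), (inferInstance : M.IsFiniteType)⟩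

/-- Coherence can be checked on a cover by affine open subsets. -/
lemma IsCoherent.of_isFiniteTilde {X : Scheme.{u}} {M : X.Modules}
    (h : ∀ x : X, ∃ (R : CommRingCat.{u}) (_ : IsNoetherianRing R) (j : Spec R ⟶ X)
      (_ : IsOpenImmersion j), x ∈ Set.range j ∧ IsFiniteTilde (M.restrict j)) :
    IsCoherent M := by
  choose R hR j hj hx hM using h
  choose P hP using fun x ↦ exists_finite_presentation_over (j x) (hM x)
  let σ : SheafOfModules.QuasicoherentData.{u} (R := X.ringCatSheaf) M :=
    { I := X
      X := fun x ↦ (j x).opensRange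
      coversTop := coversTop_of_mem _ fun x ↦ ⟨x, hx x⟩
      presentation := P }
  have hσ : σ.IsFinitePresentation :=
    SheafOfModules.QuasicoherentData.IsFinitePresentation.mk (R := X.ringCatSheaf) (M := M)
      (q := σ) hP
  have : SheafOfModules.IsFinitePresentation (R := X.ringCatSheaf) M :=
    SheafOfModules.IsFinitePresentation.mk (R := X.ringCatSheaf) (M := M) ⟨σ, hσ⟩
  exact isCoherent_of_isFinitePresentation M this

variable {X : Scheme.{u}}

lemma exists_spec_openImmersion [IsLocallyNoetherian X] (x : X) :
    ∃ (R : CommRingCat.{u}) (_ : IsNoetherianRing R) (j : Spec R ⟶ X)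
      (_ : IsOpenImmersion j), x ∈ Set.range j := by
  obtain ⟨W, hW, hx, -⟩ := exists_isAffineOpen_mem_and_subset (Opens.mem_top x)
  have : IsNoetherianRing Γ(X, W) := IsLocallyNoetherian.component_noetherian ⟨W, hW⟩
  exact ⟨Γ(X, W), this, hW.fromSpec, inferInstance, by rwa [hW.range_fromSpec]⟩

lemma IsCoherent.of_forall [IsLocallyNoetherian X] {M : X.Modules}
    (h : ∀ (R : CommRingCat.{u}) [IsNoetherianRing R] (j : Spec R ⟶ X) [IsOpenImmersion j],
      IsFiniteTilde (M.restrict j)) : IsCoherent M :=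
  .of_isFiniteTilde fun x ↦ by
    obtain ⟨R, hR, j, hj, hx⟩ := exists_spec_openImmersion x
    exact ⟨R, hR, j, hj, hx, h R j⟩

variable [IsLocallyNoetherian X] {M N : X.Modules}

lemma IsCoherent.cokernel (hM : IsCoherent M) (hN : IsCoherent N) (φ : M ⟶ N) :
    IsCoherent (cokernel φ) :=
  .of_forall fun _ _ j _ ↦ ((hM.isFiniteTilde_restrict j).cokernel (hN.isFiniteTilde_restrict j)
    ((Scheme.Modules.restrictFunctor j).map φ)).of_iso
      (PreservesCokernel.iso (Scheme.Modules.restrictFunctor j) φ).symm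

lemma IsCoherent.biprod (hM : IsCoherent M) (hN : IsCoherent N) : IsCoherent (M ⊞ N) :=
  .of_forall fun _ _ j _ ↦ by
    have := preservesBinaryBiproducts_of_preservesBinaryCoproducts
      (Scheme.Modules.restrictFunctor j)
    exact ((hM.isFiniteTilde_restrict j).biprod (hN.isFiniteTilde_restrict j)).of_iso
      ((Scheme.Modules.restrictFunctor j).mapBiprod M N).symm

/-- The kernel of a morphism from a coherent sheaf is coherent as soon as, on affine open subsets,
each section of the target that vanishes on `D(f)` is killed by a power of `f`. -/
lemma IsCoherent.kernel_of_torsion {Q : X.Modules} (hM : IsCoherent M) (ψ : M ⟶ Q)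
    (hQ : ∀ (R : CommRingCat.{u}) [IsNoetherianRing R] (j : Spec R ⟶ X) [IsOpenImmersion j] (f : R)
      (t : Γ(Q.restrict j, ⊤)), (Q.restrict j).presheaf.map (specBasicOpen f).leTop.op t = 0 →
      ∃ n : ℕ, f ^ n • t = 0) : IsCoherent (kernel ψ) :=
  .of_forall fun R _ j _ ↦ (hM.isFiniteTilde_restrict j).of_exact
    ((Scheme.Modules.restrictFunctor j).map (kernel.ι ψ))
    ((Scheme.Modules.restrictFunctor j).map ψ)
    (fun U ↦ injective_app_of_mono (kernel.ι ψ) (j ''ᵁ U))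
    (fun U s ↦ ⟨fun h ↦ exists_kernel_ι_app_eq ψ (j ''ᵁ U) s h, fun ⟨t, ht⟩ ↦ by
      subst ht; exact kernel_ι_app_apply ψ (j ''ᵁ U) t⟩)
    (hQ R j)

lemma IsCoherent.kernel (hM : IsCoherent M) (hN : IsCoherent N) (φ : M ⟶ N) :
    IsCoherent (kernel φ) :=
  hM.kernel_of_torsion φ fun _ _ j _ f t ht ↦
    (((isIso_fromTildeΓ_iff_forall _).1 (hN.isFiniteTilde_restrict j).isIso_fromTildeΓ f).2 t ht)

end coherent

/-! ### Torsion sections on an affine scheme -/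

section torsion

lemma isSMulRegular_specBasicOpen {R : CommRingCat.{u}} (M : (Spec R).Modules) (f : R) :
    IsSMulRegular Γ(M, specBasicOpen f) f :=
  M.isSMulRegular_of_le_basicOpen le_rfl

/-- A section of a quasi-coherent sheaf over an open subset `V` that vanishes on `V ∩ D(f)` is
killed by a power of `f`. -/
lemma exists_pow_smul_eq_zero {R : CommRingCat.{u}} [IsNoetherianRing R] (M : (Spec R).Modules)
    [hM : IsIso M.fromTildeΓ] (V : (Spec R).Opens) (f : R) (t : Γ(M, V))
    (ht : M.presheaf.map (homOfLE (inf_le_left : V ⊓ specBasicOpen f ≤ V)).op t = 0) :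
    ∃ n : ℕ, f ^ n • t = 0 := by
  have key := (isIso_fromTildeΓ_iff_forall M).1 hM
  have hloc (g : R) (hg : specBasicOpen g ≤ V) :
      ∃ n : ℕ, f ^ n • M.presheaf.map (homOfLE hg).op t = 0 := by
    obtain ⟨a, y, hy⟩ := (key g).1 (M.presheaf.map (homOfLE hg).op t)
    have hfg : specBasicOpen (f * g) ≤ V ⊓ specBasicOpen f :=
      le_inf ((PrimeSpectrum.basicOpen_mul_le_right f g).trans hg)
        (PrimeSpectrum.basicOpen_mul_le_left f g)
    have hfg' : specBasicOpen (f * g) ≤ specBasicOpen g := PrimeSpectrum.basicOpen_mul_le_right f g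
    obtain ⟨n, hn⟩ := (key (f * g)).2 y (by
      have h₁ : M.presheaf.map (homOfLE hfg').op (M.presheaf.map (specBasicOpen g).leTop.op y) =
          M.presheaf.map (specBasicOpen (f * g)).leTop.op y := by
        rw [← ConcreteCategory.comp_apply, ← Functor.map_comp]; rfl
      have h₂ : M.presheaf.map (homOfLE hfg').op (M.presheaf.map (homOfLE hg).op t) =
          M.presheaf.map (homOfLE hfg).op (M.presheaf.map
            (homOfLE (inf_le_left : V ⊓ specBasicOpen f ≤ V)).op t) := by
        rw [← ConcreteCategory.comp_apply, ← ConcreteCategory.comp_apply, ← Functor.map_comp,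
          ← Functor.map_comp]; rfl
      rw [← h₁, ← hy, Scheme.Modules.map_smul_Spec, h₂, ht, map_zero, smul_zero])
    refine ⟨n, ((isSMulRegular_specBasicOpen M g).pow
      (n + a)).right_eq_zero_of_smul ?_⟩
    rw [smul_comm, pow_add, mul_smul, hy, ← Scheme.Modules.map_smul_Spec,
      ← Scheme.Modules.map_smul_Spec, ← mul_smul, ← mul_pow, hn, map_zero]
  -- finitely many basic open subsets cover `V`
  obtain ⟨κ, _, g, hV⟩ := (PrimeSpectrum.isBasis_basic_opens (R := R)).exists_iSup_eq_of_isCompact V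
    (NoetherianSpace.isCompact _)
  have hg (k : κ) : specBasicOpen (g k) ≤ V := by
    rw [hV]
    exact le_iSup (fun k ↦ specBasicOpen (g k)) k
  choose n hn using fun k ↦ hloc (g k) (hg k)
  have hb : BddAbove (Set.range n) := Set.finite_range n |>.bddAbove
  refine ⟨⨆ k, n k, TopCat.Sheaf.eq_of_locally_eq' ⟨_, M.isSheaf⟩ (fun k ↦ specBasicOpen (g k)) V
    (fun k ↦ homOfLE (hg k)) hV.le _ _ fun k ↦ ?_⟩
  change M.presheaf.map (homOfLE (hg k)).op _ = M.presheaf.map (homOfLE (hg k)).op 0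
  rw [map_zero, Scheme.Modules.map_smul_Spec, ← Nat.sub_add_cancel (le_ciSup hb k), pow_add,
    mul_smul, hn, smul_zero]

variable {X : Scheme.{u}}

/-- The action of `R` on the sections of a restriction to `Spec R`, in terms of functions on `X`. -/
lemma restrict_smul_spec {R : CommRingCat.{u}} (E : X.Modules) (j : Spec R ⟶ X) [IsOpenImmersion j]
    (V : (Spec R).Opens) (r : R) (s : Γ(E.restrict j, V)) :
    (E.restrictAppIso j V).hom (r • s) =
      X.presheaf.map (homOfLE (j.image_mono (le_top : V ≤ ⊤))).op
        ((j.appIso ⊤).inv ((Scheme.ΓSpecIso R).inv r)) • (E.restrictAppIso j V).hom s := by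
  rw [Scheme.Modules.smul_Spec_def, Scheme.Modules.smul_restrictAppIso_hom_apply]
  congr 1
  exact congr($(j.appIso_inv_naturality V.leTop.op) ((Scheme.ΓSpecIso R).inv r))

end torsion

/-! ### Restriction to an open subset followed by extension -/

section extension
variable {X : Scheme.{u}}

/-- The sheaf `V ↦ Γ(E, U ∩ V)`: restriction to the open subset `U` followed by extension. -/
noncomputable def restrictExtend (E : X.Modules) (U : X.Opens) : X.Modules :=
  (Scheme.Modules.pushforward U.ι).obj (E.restrict U.ι)

/-- The restriction maps `Γ(E, V) ⟶ Γ(E, U ∩ V)`. -/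
noncomputable def toRestrictExtend (E : X.Modules) (U : X.Opens) : E ⟶ restrictExtend E U :=
  (Scheme.Modules.restrictAdjunction U.ι).unit.app E

/-- Sections over `V` of `restrictExtend E U` as sections of `E`. -/
noncomputable def restrictExtendAppIso (E : X.Modules) (U V : X.Opens) :
    Γ(restrictExtend E U, V) ≅ Γ(E, U.ι ''ᵁ U.ι ⁻¹ᵁ V) := Iso.refl _

lemma restrictExtend_smul (E : X.Modules) (U V : X.Opens) (r : Γ(X, V))
    (s : Γ(restrictExtend E U, V)) :
    (restrictExtendAppIso E U V).hom (r • s) =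
      X.presheaf.map (homOfLE (U.ι.image_preimage_le V)).op r •
        (restrictExtendAppIso E U V).hom s := by
  have h : (U.ι.appIso _).inv (U.ι.app V r) =
      X.presheaf.map (homOfLE (U.ι.image_preimage_le V)).op r := congr($(U.ι.app_appIso_inv V) r)
  rw [← h]
  rfl

lemma map_map_apply (E : X.Modules) {U V W : X.Opens} (i : V ⟶ U) (i' : W ⟶ V) (s : Γ(E, U)) :
    E.presheaf.map i'.op (E.presheaf.map i.op s) = E.presheaf.map (i' ≫ i).op s := by
  rw [op_comp, Functor.map_comp, ConcreteCategory.comp_apply]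

/-- The sections of `restrictExtend E U` over an affine open subset `V` are those of `E` over
`U ∩ V`; the ones that vanish on `D(f)` are killed by a power of `f`. -/
lemma restrictExtend_torsion [IsLocallyNoetherian X] {E : X.Modules} (hE : IsCoherent E)
    (U : X.Opens) (R : CommRingCat.{u}) [IsNoetherianRing R] (j : Spec R ⟶ X) [IsOpenImmersion j]
    (f : R) (t : Γ((restrictExtend E U).restrict j, ⊤))
    (ht : ((restrictExtend E U).restrict j).presheaf.map (specBasicOpen f).leTop.op t = 0) :
    ∃ n : ℕ, f ^ n • t = 0 := by
  have hM := (hE.isFiniteTilde_restrict j).isIso_fromTildeΓ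
  let V : (Spec R).Opens := j ⁻¹ᵁ U
  have hV (W : (Spec R).Opens) : U.ι ''ᵁ U.ι ⁻¹ᵁ j ''ᵁ W = j ''ᵁ (V ⊓ W) := by
    rw [Scheme.Hom.image_preimage_eq_opensRange_inf, Scheme.Opens.opensRange_ι]
    ext x
    constructor
    · rintro ⟨hx, p, hp, rfl⟩
      exact ⟨p, ⟨hx, hp⟩, rfl⟩
    · rintro ⟨p, ⟨hx, hp⟩, rfl⟩
      exact ⟨hx, p, hp, rfl⟩
  let a (r : R) : Γ(X, j ''ᵁ ⊤) := (j.appIso ⊤).inv ((Scheme.ΓSpecIso R).inv r)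
  let i (W : (Spec R).Opens) : j ''ᵁ (V ⊓ W) ⟶ U.ι ''ᵁ U.ι ⁻¹ᵁ j ''ᵁ W := eqToHom (hV W).symm
  let α (W : (Spec R).Opens) : Γ((restrictExtend E U).restrict j, W) ≅
      Γ(E, U.ι ''ᵁ U.ι ⁻¹ᵁ j ''ᵁ W) :=
    (restrictExtend E U).restrictAppIso j W ≪≫ restrictExtendAppIso E U (j ''ᵁ W)
  have hα (W) (r : R) (x) : (α W).hom (r • x) =
      X.presheaf.map (homOfLE ((U.ι.image_preimage_le _).trans
        (j.image_mono (le_top : W ≤ ⊤)))).op (a r) • (α W).hom x := by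
    change (restrictExtendAppIso E U (j ''ᵁ W)).hom
      (((restrictExtend E U).restrictAppIso j W).hom (r • x)) = _
    rw [restrict_smul_spec, restrictExtend_smul, ← ConcreteCategory.comp_apply, ← Functor.map_comp]
    rfl
  -- sections of `restrictExtend E U` over `W` as sections of `E` over `V ⊓ W`, compatibly with the
  -- action of `R` and with restriction
  let θ (W : (Spec R).Opens) : Γ((restrictExtend E U).restrict j, W) ≅ Γ(E.restrict j, V ⊓ W) :=
    α W ≪≫ E.presheaf.mapIso (eqToIso (hV W).symm).op ≪≫ (E.restrictAppIso j (V ⊓ W)).symm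
  have hθ (W) (x) : (E.restrictAppIso j (V ⊓ W)).hom ((θ W).hom x) =
    E.presheaf.map (i W).op ((α W).hom x) := rfl
  have hinj (W) : Function.Injective (θ W).hom := (ConcreteCategory.bijective_of_isIso _).1
  have hsmul (W) (r : R) (x) : (θ W).hom (r • x) = r • (θ W).hom x := by
    apply (ConcreteCategory.bijective_of_isIso (E.restrictAppIso j (V ⊓ W)).hom).1
    rw [hθ, hα, restrict_smul_spec, hθ, Scheme.Modules.map_smul, ← ConcreteCategory.comp_apply,
      ← Functor.map_comp]
    rfl
  have hres {W W' : (Spec R).Opens} (k : W' ⟶ W) (x) :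
      (θ W').hom (((restrictExtend E U).restrict j).presheaf.map k.op x) =
      (E.restrict j).presheaf.map (homOfLE (inf_le_inf_left V k.le)).op ((θ W).hom x) := by
    change E.presheaf.map (i W').op (E.presheaf.map (homOfLE (U.ι.image_mono (U.ι.preimage_mono
        (j.image_mono k.le)))).op ((α W).hom x)) =
      E.presheaf.map (homOfLE (j.image_mono (inf_le_inf_left V k.le))).op
        (E.presheaf.map (i W).op ((α W).hom x))
    rw [map_map_apply, map_map_apply]
    rfl
  obtain ⟨n, hn⟩ := exists_pow_smul_eq_zero (E.restrict j) (V ⊓ ⊤) f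
    ((θ ⊤).hom t) (by
      have h := hres (specBasicOpen f).leTop t
      rw [ht, map_zero] at h
      have h' := congrArg ((E.restrict j).presheaf.map
        (homOfLE (by simp : (V ⊓ ⊤) ⊓ specBasicOpen f ≤ V ⊓ specBasicOpen f)).op) h
      rw [map_zero, map_map_apply] at h'
      exact h'.symm)
  exact ⟨n, hinj _ (by rw [hsmul, hn, map_zero])⟩

end extension

/-! ### Supports of coherent sheaves, kernels and cokernels -/

section support
variable {X : Scheme.{u}}

lemma supp_eq_of_iso {M N : X.Modules} (e : M ≅ N) : supp M = supp N := by
  ext x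
  exact ⟨mem_supp_of_over_iso (x := x) ⊤
      ((SheafOfModules.overFunctor X.ringCatSheaf ⊤).mapIso e.symm) trivial,
    mem_supp_of_over_iso (x := x) ⊤
      ((SheafOfModules.overFunctor X.ringCatSheaf ⊤).mapIso e) trivial⟩

lemma mem_supp_restrict {Y : Scheme.{u}} (j : Y ⟶ X) [IsOpenImmersion j] (M : X.Modules) (y : Y) :
    y ∈ supp (M.restrict j) ↔ j y ∈ supp M := by
  let e : (M.restrict j).presheaf.stalk y ≅ M.presheaf.stalk (j y) :=
    (Scheme.Modules.restrictStalkNatIso j y).app M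
  exact e.addCommGroupIsoToAddEquiv.toEquiv.nontrivial_congr

lemma nontrivial_iff_of_isLocalizedModule {R : Type*} [CommRing R] {N T : ModuleCat R}
    (S : Submonoid R) (g : N ⟶ T) (hg : IsLocalizedModule S g.hom) :
    Nontrivial T ↔ Nontrivial (LocalizedModule S N) :=
  (IsLocalizedModule.iso S g.hom).toEquiv.nontrivial_congr.symm

lemma mem_supp_tilde {R : CommRingCat.{u}} (N : ModuleCat.{u} R) (x : PrimeSpectrum R) :
    (show Spec R from x) ∈ supp (tilde N) ↔ x ∈ Module.support R N := by
  rw [Module.mem_support_iff]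
  -- the instance is given by name, since `x` has to be read as a point of `PrimeSpectrum.Top R`
  exact nontrivial_iff_of_isLocalizedModule _ (tilde.toStalk N x)
    (tilde.instIsLocalizedModuleCarrierCarrierOfCarrierStalkAbPresheafPrimeComplAsIdealHomToStalk
      N x)

lemma isClosed_supp_tilde {R : CommRingCat.{u}} (N : ModuleCat.{u} R) [Module.Finite R N] :
    IsClosed (supp (tilde N)) := by
  have h : IsClosed (Module.support R N) := by
    rw [Module.support_eq_zeroLocus]
    exact PrimeSpectrum.isClosed_zeroLocus _
  exact (Set.ext fun x ↦ mem_supp_tilde N x : supp (tilde N) = Module.support R N) ▸ h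

lemma IsCoherent.isClosed_supp [IsLocallyNoetherian X] {M : X.Modules} (hM : IsCoherent M) :
    IsClosed (supp M) := by
  rw [← isOpen_compl_iff, isOpen_iff_mem_nhds]
  intro x hx
  obtain ⟨R, hR, j, hj, p, rfl⟩ := exists_spec_openImmersion x
  obtain ⟨N, hN, ⟨e⟩⟩ := hM.isFiniteTilde_restrict j
  have hcl : IsClosed (supp (M.restrict j)) := by
    rw [← supp_eq_of_iso e]
    exact isClosed_supp_tilde N
  refine Filter.mem_of_superset ((j.isOpenEmbedding.isOpenMap _ hcl.isOpen_compl).mem_nhds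
    ⟨p, fun h ↦ hx ((mem_supp_restrict j M p).1 h), rfl⟩) ?_
  rintro _ ⟨q, hq, rfl⟩ h
  exact hq ((mem_supp_restrict j M q).2 h)

lemma isZero_restrict_iff {M : X.Modules} {W : X.Opens} :
    IsZero (M.restrict W.ι) ↔ Disjoint (W : Set X) (supp M) := by
  constructor
  · intro h
    refine Set.disjoint_left.2 fun x hx hx' ↦ ?_
    have : supp (M.restrict W.ι) = ∅ := by
      have := (disjoint_supp_iff (M := M.restrict W.ι) (W := ⊤)).2 fun V _ s ↦ by
        have h₁ := congr(Scheme.Modules.Hom.app $((IsZero.iff_id_eq_zero _).1 h) V s)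
        exact h₁
      simpa using this
    have h₂ := (mem_supp_restrict W.ι M ⟨x, hx⟩).2 hx'
    rw [this] at h₂
    exact h₂
  · intro h
    refine isZero_of_supp_eq_empty (Set.eq_empty_of_forall_notMem fun y hy ↦ ?_)
    exact Set.disjoint_left.1 h y.2 ((mem_supp_restrict W.ι M y).1 hy)

lemma supp_subset_of_mono {K M : X.Modules} (φ : K ⟶ M) [Mono φ] (hM : IsClosed (supp M)) :
    supp K ⊆ supp M := by
  have h := (disjoint_supp_iff (M := K) (W := ⟨(supp M)ᶜ, hM.isOpen_compl⟩)).2 fun V hV s ↦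
    injective_app_of_mono φ V (by
      rw [map_zero]
      exact disjoint_supp_iff.1 disjoint_compl_left V hV _)
  exact Set.disjoint_compl_left_iff_subset.1 h

/-- If `φ` is an epimorphism over `W`, then the support of its cokernel avoids `W`. -/
lemma disjoint_supp_cokernel {M N : X.Modules} (φ : M ⟶ N) (W : X.Opens)
    [Epi ((Scheme.Modules.restrictFunctor W.ι).map φ)] :
    Disjoint (W : Set X) (supp (cokernel φ)) :=
  isZero_restrict_iff.1
    ((isZero_cokernel_of_epi ((Scheme.Modules.restrictFunctor W.ι).map φ)).of_iso
    (PreservesCokernel.iso (Scheme.Modules.restrictFunctor W.ι) φ))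

lemma supp_cokernel_subset {M N : X.Modules} (φ : M ⟶ N) (hN : IsClosed (supp N)) :
    supp (cokernel φ) ⊆ supp N := by
  let W : X.Opens := ⟨(supp N)ᶜ, hN.isOpen_compl⟩
  have h : IsZero (N.restrict W.ι) := isZero_restrict_iff.2 disjoint_compl_left
  have : Epi ((Scheme.Modules.restrictFunctor W.ι).map φ) := ⟨fun _ _ _ ↦ h.eq_of_src _ _⟩
  exact Set.disjoint_compl_left_iff_subset.1 (disjoint_supp_cokernel φ W)

/-- If `φ` is injective on sections over the open subsets of `W`, then the support of its kernel
avoids `W`. -/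
lemma disjoint_supp_kernel {M N : X.Modules} (φ : M ⟶ N) (W : X.Opens)
    (h : ∀ V ≤ W, ∀ s : Γ(M, V), φ.app V s = 0 → s = 0) :
    Disjoint (W : Set X) (supp (kernel φ)) :=
  disjoint_supp_iff.2 fun V hV s ↦ injective_app_of_mono (kernel.ι φ) V (by
    rw [map_zero, h V hV _ (kernel_ι_app_apply φ V s)])

lemma epi_restrict_of_bijective {M N : X.Modules} (φ : M ⟶ N) (W : X.Opens)
    (h : ∀ V ≤ W, Function.Bijective (φ.app V)) :
    Epi ((Scheme.Modules.restrictFunctor W.ι).map φ) := by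
  have : IsIso ((Scheme.Modules.restrictFunctor W.ι).map φ) := by
    rw [Scheme.Modules.Hom.isIso_iff_isIso_app]
    intro V
    rw [ConcreteCategory.isIso_iff_bijective]
    exact h (W.ι ''ᵁ V) (by rintro _ ⟨x, _, rfl⟩; exact x.2)
  infer_instance

end support

/-! ### Dévissage and graphs of isomorphisms over an open subset -/

section devissage
variable {X : Scheme.{u}}

lemma toRestrictExtend_app_bijective (E : X.Modules) (U V : X.Opens) (h : V ≤ U) :
    Function.Bijective ((toRestrictExtend E U).app V) := by
  have hV : V ≤ U.ι ''ᵁ U.ι ⁻¹ᵁ V := by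
    rw [Scheme.Hom.image_preimage_eq_opensRange_inf, Scheme.Opens.opensRange_ι]
    exact le_inf h le_rfl
  have e : U.ι ''ᵁ U.ι ⁻¹ᵁ V = V := le_antisymm (U.ι.image_preimage_le V) hV
  have h₁ : Function.Bijective (E.presheaf.map (eqToHom e).op) :=
    ConcreteCategory.bijective_of_isIso _
  have h₂ : Function.Bijective (restrictExtendAppIso E U V).hom :=
    ConcreteCategory.bijective_of_isIso _
  exact (Function.Bijective.of_comp_iff' h₂ _).1 h₁

/-- The subsheaf of sections with support in the complement of `U`. -/
noncomputable def sectionsOff (F : X.Modules) (U : X.Opens) : X.Modules :=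
  kernel (toRestrictExtend F U)

/-- The inclusion of the subsheaf of sections with support in the complement of `U`. -/
noncomputable def sectionsOffι (F : X.Modules) (U : X.Opens) : sectionsOff F U ⟶ F :=
  kernel.ι (toRestrictExtend F U)

instance (F : X.Modules) (U : X.Opens) : Mono (sectionsOffι F U) :=
  inferInstanceAs (Mono (kernel.ι _))

lemma IsCoherent.sectionsOff [IsLocallyNoetherian X] {F : X.Modules} (hF : IsCoherent F)
    (U : X.Opens) : IsCoherent (sectionsOff F U) :=
  hF.kernel_of_torsion (toRestrictExtend F U) (restrictExtend_torsion hF U)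

lemma disjoint_supp_sectionsOff (F : X.Modules) (U : X.Opens) :
    Disjoint (U : Set X) (supp (sectionsOff F U)) :=
  disjoint_supp_kernel _ U fun V hV s hs ↦
    (toRestrictExtend_app_bijective F U V hV).1 (by rw [hs, map_zero])

/-- If `F` has no support on `U ∩ W`, then all its sections over `W` are supported off `U`, so the
quotient by the subsheaf of such sections vanishes on `W`. -/
lemma disjoint_supp_cokernel_sectionsOffι (F : X.Modules) (U W : X.Opens)
    (h : Disjoint ((U ⊓ W : X.Opens) : Set X) (supp F)) :
    Disjoint (W : Set X) (supp (cokernel (sectionsOffι F U))) := by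
  have : Epi ((Scheme.Modules.restrictFunctor W.ι).map (sectionsOffι F U)) := by
    refine epi_restrict_of_bijective _ W fun V hV ↦ ⟨injective_app_of_mono _ V, fun s ↦ ?_⟩
    refine exists_kernel_ι_app_eq _ V s ?_
    have h₂ : Function.Bijective (restrictExtendAppIso F U V).hom :=
      ConcreteCategory.bijective_of_isIso _
    refine h₂.1 (disjoint_supp_iff.1 h _ ?_ _ |>.trans (map_zero _).symm)
    rw [Scheme.Hom.image_preimage_eq_opensRange_inf, Scheme.Opens.opensRange_ι]
    exact inf_le_inf_left _ hV
  exact disjoint_supp_cokernel _ W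

end devissage

section graph
variable {X : Scheme.{u}}

/-- An isomorphism over an open subset as an isomorphism of restrictions. -/
lemma restrict_iso_of_over_iso {F E : X.Modules} (U : X.Opens)
    (h : Nonempty (SheafOfModules.over F U ≅ SheafOfModules.over E U)) :
    Nonempty (F.restrict U.ι ≅ E.restrict U.ι) := by
  obtain ⟨e⟩ := h
  exact ⟨((Scheme.Modules.overFunctorEquiv U).app F).symm ≪≫
    (Scheme.Modules.overEquiv U).functor.mapIso e ≪≫ (Scheme.Modules.overFunctorEquiv U).app E⟩

variable {F E : X.Modules} {U : X.Opens} (φ : F.restrict U.ι ≅ E.restrict U.ι)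

/-- The isomorphism of extensions induced by an isomorphism over `U`. -/
noncomputable def restrictExtendIso : restrictExtend F U ≅ restrictExtend E U :=
  (Scheme.Modules.pushforward U.ι).mapIso φ

/-- The map `F ⊞ E ⟶ ι_* ι^* E`, `(x, y) ↦ φ x - y`, whose kernel is the graph of `φ`. -/
noncomputable def graphMap : F ⊞ E ⟶ restrictExtend E U :=
  biprod.desc (toRestrictExtend F U ≫ (restrictExtendIso φ).hom)
    (-(toRestrictExtend E U))

/-- The largest subsheaf of `F ⊞ E` that is over `U` the graph of `φ`. -/
noncomputable def graph : X.Modules := kernel (graphMap φ)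

/-- The inclusion of the graph. -/
noncomputable def graphι : graph φ ⟶ F ⊞ E := kernel.ι (graphMap φ)

instance : Mono (graphι φ) := inferInstanceAs (Mono (kernel.ι _))

/-- The first projection of the graph. -/
noncomputable def graphFst : graph φ ⟶ F := graphι φ ≫ biprod.fst

/-- The second projection of the graph. -/
noncomputable def graphSnd : graph φ ⟶ E := graphι φ ≫ biprod.snd

lemma isCoherent_graph [IsLocallyNoetherian X] (hF : IsCoherent F) (hE : IsCoherent E) :
    IsCoherent (graph φ) :=
  (hF.biprod hE).kernel_of_torsion (graphMap φ) (restrictExtend_torsion hE U)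

lemma graph_condition (V : X.Opens) (s : Γ(graph φ, V)) :
    (restrictExtendIso φ).hom.app V
      ((toRestrictExtend F U).app V ((graphFst φ).app V s)) =
      (toRestrictExtend E U).app V ((graphSnd φ).app V s) := by
  have h : graphFst φ ≫ toRestrictExtend F U ≫ (restrictExtendIso φ).hom =
      graphSnd φ ≫ toRestrictExtend E U := by
    have h : graphMap φ = biprod.fst ≫ toRestrictExtend F U ≫ (restrictExtendIso φ).hom -
        biprod.snd ≫ toRestrictExtend E U := by
      simp [graphMap, biprod.desc_eq, sub_eq_add_neg]
    have h' := kernel.condition (graphMap φ)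
    rw [← sub_eq_zero, graphFst, graphSnd, Category.assoc, Category.assoc, ← Preadditive.comp_sub,
      ← h]
    exact h'
  exact congr(Scheme.Modules.Hom.app $h V s)

lemma exists_graph_section (V : X.Opens) (x : Γ(F, V)) (y : Γ(E, V))
    (h : (restrictExtendIso φ).hom.app V ((toRestrictExtend F U).app V x) =
      (toRestrictExtend E U).app V y) :
    ∃ s : Γ(graph φ, V), (graphFst φ).app V s = x ∧ (graphSnd φ).app V s = y := by
  have h₁ : (biprod.inl : F ⟶ F ⊞ E) ≫ graphMap φ =
    toRestrictExtend F U ≫ (restrictExtendIso φ).hom := by simp [graphMap]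
  have h₂ : (biprod.inr : E ⟶ F ⊞ E) ≫ graphMap φ = -(toRestrictExtend E U) := by simp [graphMap]
  obtain ⟨s, hs⟩ := exists_kernel_ι_app_eq (graphMap φ) V
    ((biprod.inl : F ⟶ F ⊞ E).app V x + (biprod.inr : E ⟶ F ⊞ E).app V y) (by
      rw [map_add]
      refine (congrArg₂ (· + ·) congr(Scheme.Modules.Hom.app $h₁ V x)
        congr(Scheme.Modules.Hom.app $h₂ V y)).trans ?_
      refine (congrArg₂ (· + ·) h rfl).trans (add_neg_cancel _))
  refine ⟨s, ?_, ?_⟩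
  · change (biprod.fst : F ⊞ E ⟶ F).app V ((kernel.ι (graphMap φ)).app V s) = x
    rw [hs, map_add]
    refine (congrArg₂ (· + ·) congr(Scheme.Modules.Hom.app $(biprod.inl_fst) V x)
      congr(Scheme.Modules.Hom.app $(biprod.inr_fst) V y)).trans ?_
    exact add_zero _
  · change (biprod.snd : F ⊞ E ⟶ E).app V ((kernel.ι (graphMap φ)).app V s) = y
    rw [hs, map_add]
    refine (congrArg₂ (· + ·) congr(Scheme.Modules.Hom.app $(biprod.inl_snd) V x)
      congr(Scheme.Modules.Hom.app $(biprod.inr_snd) V y)).trans ?_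
    exact zero_add _

lemma graph_ext (V : X.Opens) (s t : Γ(graph φ, V))
    (h₁ : (graphFst φ).app V s = (graphFst φ).app V t)
    (h₂ : (graphSnd φ).app V s = (graphSnd φ).app V t) : s = t := by
  apply injective_app_of_mono (graphι φ) V
  have h (z : Γ(F ⊞ E, V)) : z = (biprod.inl : F ⟶ F ⊞ E).app V ((biprod.fst : F ⊞ E ⟶ F).app V z) +
      (biprod.inr : E ⟶ F ⊞ E).app V ((biprod.snd : F ⊞ E ⟶ E).app V z) :=
    congr(Scheme.Modules.Hom.app $(biprod.total.symm) V z)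
  rw [h ((graphι φ).app V s), h ((graphι φ).app V t)]
  exact congrArg₂ (fun a b ↦ (biprod.inl : F ⟶ F ⊞ E).app V a + (biprod.inr : E ⟶ F ⊞ E).app V b)
    h₁ h₂

lemma restrictExtendIso_app_bijective (V : X.Opens) :
    Function.Bijective ((restrictExtendIso φ).hom.app V) :=
  ConcreteCategory.bijective_of_isIso _

lemma graphFst_bijective (V : X.Opens) (hV : V ≤ U) : Function.Bijective ((graphFst φ).app V) := by
  constructor
  · intro s t h
    refine graph_ext φ V s t h ((toRestrictExtend_app_bijective E U V hV).1 ?_)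
    rw [← graph_condition, ← graph_condition, h]
  · intro x
    obtain ⟨y, hy⟩ := (toRestrictExtend_app_bijective E U V hV).2
      ((restrictExtendIso φ).hom.app V ((toRestrictExtend F U).app V x))
    obtain ⟨s, h, -⟩ := exists_graph_section φ V x y hy.symm
    exact ⟨s, h⟩

lemma graphSnd_bijective (V : X.Opens) (hV : V ≤ U) : Function.Bijective ((graphSnd φ).app V) := by
  constructor
  · intro s t h
    refine graph_ext φ V s t ((toRestrictExtend_app_bijective F U V hV).1
      ((restrictExtendIso_app_bijective φ V).1 ?_)) h
    rw [graph_condition, graph_condition, h]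
  · intro y
    obtain ⟨z, hz⟩ := (restrictExtendIso_app_bijective φ V).2 ((toRestrictExtend E U).app V y)
    obtain ⟨x, rfl⟩ := (toRestrictExtend_app_bijective F U V hV).2 z
    obtain ⟨s, -, h⟩ := exists_graph_section φ V x y hz
    exact ⟨s, h⟩

lemma supp_graph_subset (hF : IsClosed (supp F)) (hE : IsClosed (supp E)) :
    supp (graph φ) ⊆ supp F ∪ supp E := by
  refine Set.disjoint_compl_left_iff_subset.1 ((disjoint_supp_iff (M := graph φ)
    (W := ⟨(supp F ∪ supp E)ᶜ, (hF.union hE).isOpen_compl⟩)).2 fun V hV s ↦ ?_)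
  refine graph_ext φ V s 0 ?_ ?_
  · rw [map_zero]
    exact disjoint_supp_iff.1 (Set.disjoint_compl_left_iff_subset.2 le_rfl) V
      (hV.trans (fun x hx h ↦ hx (.inl h)) : V ≤ ⟨(supp F)ᶜ, hF.isOpen_compl⟩) _
  · rw [map_zero]
    exact disjoint_supp_iff.1 (Set.disjoint_compl_left_iff_subset.2 le_rfl) V
      (hV.trans (fun x hx h ↦ hx (.inr h)) : V ≤ ⟨(supp E)ᶜ, hE.isOpen_compl⟩) _

/-- A morphism that is bijective over `U` has kernel and cokernel supported off `U`. -/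
lemma disjoint_supp_of_bijective {M N : X.Modules} (ψ : M ⟶ N) (U : X.Opens)
    (h : ∀ V ≤ U, Function.Bijective (ψ.app V)) :
    Disjoint (U : Set X) (supp (kernel ψ)) ∧ Disjoint (U : Set X) (supp (cokernel ψ)) := by
  have := epi_restrict_of_bijective ψ U h
  exact ⟨disjoint_supp_kernel ψ U fun V hV s hs ↦ (h V hV).1 (by rw [hs, map_zero]),
    disjoint_supp_cokernel ψ U⟩

end graph

/-! ### Classes in the Grothendieck group -/

section Kgroup
variable {X S : Scheme.{u}} (f : X ⟶ S)

lemma clsK_shortExact {T : ShortComplex X.Modules} (hT : T.ShortExact) (h₁ : MemF f T.X₁)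
    (h₂ : MemF f T.X₂) (h₃ : MemF f T.X₃) :
    clsK f ⟨T.X₂, h₂⟩ = clsK f ⟨T.X₁, h₁⟩ + clsK f ⟨T.X₃, h₃⟩ := by
  have h : (QuotientAddGroup.mk ((.of ⟨T.X₂, h₂⟩ - .of ⟨T.X₁, h₁⟩ - .of ⟨T.X₃, h₃⟩ :
      FreeAbelianGroup (CohF f))) : FreeAbelianGroup (CohF f) ⧸ AddSubgroup.closure (relK f)) = 0 :=
    (QuotientAddGroup.eq_zero_iff _).2 (AddSubgroup.subset_closure ⟨T, h₁, h₂, h₃, hT, rfl⟩)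
  have h' : clsK f ⟨T.X₂, h₂⟩ - clsK f ⟨T.X₁, h₁⟩ - clsK f ⟨T.X₃, h₃⟩ = 0 := h
  rwa [sub_sub, sub_eq_zero] at h'

lemma clsK_of_isZero {M : X.Modules} (hM : MemF f M) (h : IsZero M) : clsK f ⟨M, hM⟩ = 0 := by
  have hT : (ShortComplex.mk (0 : M ⟶ M) (0 : M ⟶ M) zero_comp).ShortExact :=
    { exact := ShortComplex.exact_of_isZero_X₂ _ h
      mono_f := ⟨fun _ _ _ ↦ h.eq_of_tgt _ _⟩
      epi_g := ⟨fun _ _ _ ↦ h.eq_of_src _ _⟩ }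
  simpa using clsK_shortExact f hT hM hM hM

lemma clsK_of_supp_eq_empty {M : X.Modules} (hM : MemF f M) (h : supp M = ∅) :
    clsK f ⟨M, hM⟩ = 0 := clsK_of_isZero f hM (isZero_of_supp_eq_empty h)

/-- A closed subset of a support that is proper over an Artin subscheme is itself proper over it,
with its reduced structure. -/
lemma MemF.of_supp_subset {M F : X.Modules} (hF : MemF f F) (hM : IsCoherent M)
    (hcl : IsClosed (supp M)) (h : supp M ⊆ supp F) : MemF f M := by
  obtain ⟨Y, A, i, j, g, hi, hY, hj, hA, hg, e⟩ := hF.support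
  let I := Scheme.IdealSheafData.vanishingIdeal
    (⟨i ⁻¹' supp M, hcl.preimage i.continuous⟩ : Closeds Y)
  refine ⟨hM, I.subscheme, A, I.subschemeι ≫ i, j, I.subschemeι ≫ g, inferInstance, ?_, hj, hA,
    inferInstance, by rw [Category.assoc, Category.assoc, e]⟩
  have hI : Set.range I.subschemeι = i ⁻¹' supp M := by
    rw [Scheme.IdealSheafData.range_subschemeι, Scheme.IdealSheafData.coe_support_vanishingIdeal]
    rfl
  rw [Scheme.Hom.comp_base, TopCat.coe_comp, Set.range_comp, hI,
    Set.image_preimage_eq_inter_range, hY, Set.inter_eq_left.2 h]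

/-- The support is of finite type over an Artinian scheme. -/
lemma noetherianSpace_supp {F : X.Modules} (hF : MemF f F) : NoetherianSpace (supp F) := by
  obtain ⟨Y, A, i, j, g, hi, hY, hj, hA, hg, e⟩ := hF.support
  have : IsLocallyNoetherian Y := LocallyOfFiniteType.isLocallyNoetherian g
  have : CompactSpace Y := QuasiCompact.compactSpace_of_compactSpace g
  have : IsNoetherian Y := {}
  rw [← hY]
  exact NoetherianSpace.range _ i.continuous

variable [IsLocallyNoetherian X]

lemma MemF.kernel {M N : X.Modules} (hM : MemF f M) (hN : IsCoherent N) (φ : M ⟶ N) :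
    MemF f (kernel φ) :=
  have h := IsCoherent.kernel hM.1 hN φ
  hM.of_supp_subset f h h.isClosed_supp
    (supp_subset_of_mono (kernel.ι φ) hM.1.isClosed_supp)

lemma MemF.cokernel {M N : X.Modules} (hM : IsCoherent M) (hN : MemF f N) (φ : M ⟶ N) :
    MemF f (cokernel φ) :=
  have h := IsCoherent.cokernel hM hN.1 φ
  hN.of_supp_subset f h h.isClosed_supp (supp_cokernel_subset φ hN.1.isClosed_supp)

lemma clsK_mono {M N : X.Modules} (hM : MemF f M) (hN : MemF f N) (φ : M ⟶ N) [Mono φ] :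
    clsK f ⟨N, hN⟩ = clsK f ⟨M, hM⟩ + clsK f ⟨cokernel φ, hN.cokernel f hM.1 φ⟩ :=
  clsK_shortExact f (T := ShortComplex.mk φ (cokernel.π φ) (cokernel.condition φ))
    { exact := ShortComplex.exact_cokernel φ } hM hN _

/-- The difference of two classes in terms of the kernel and the cokernel of a morphism. -/
lemma clsK_sub_clsK {M N : X.Modules} (hM : MemF f M) (hN : MemF f N) (φ : M ⟶ N) :
    clsK f ⟨M, hM⟩ - clsK f ⟨N, hN⟩ = clsK f ⟨kernel φ, hM.kernel f hN.1 φ⟩ -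
      clsK f ⟨cokernel φ, hN.cokernel f hM.1 φ⟩ := by
  have hI : MemF f (Abelian.image φ) := hN.kernel f (hN.cokernel f hM.1 φ).1 _
  have h₀ : kernel.ι φ ≫ Abelian.factorThruImage φ = 0 := by
    rw [← cancel_mono (Abelian.image.ι φ), Category.assoc, Abelian.image.fac, kernel.condition,
      zero_comp]
  have h₁ := clsK_shortExact f
    (T := ShortComplex.mk (kernel.ι φ) (Abelian.factorThruImage φ) h₀)
    { exact := (ShortComplex.exact_iff_of_epi_of_isIso_of_mono
        (S₁ := ShortComplex.mk (kernel.ι φ) (Abelian.factorThruImage φ) h₀)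
        (S₂ := ShortComplex.mk (kernel.ι φ) φ (kernel.condition φ))
        { τ₁ := 𝟙 _, τ₂ := 𝟙 _, τ₃ := Abelian.image.ι φ }).2 (ShortComplex.exact_kernel φ) }
    (hM.kernel f hN.1 φ) hM hI
  have h₂ := clsK_shortExact f (T := ShortComplex.mk (Abelian.image.ι φ) (cokernel.π φ)
      (kernel.condition _)) { exact := ShortComplex.exact_kernel (cokernel.π φ) } hI hN
      (hN.cokernel f hM.1 φ)
  simp only at h₁ h₂
  rw [h₁, h₂]
  abel

lemma clsK_of_iso {M N : X.Modules} (hM : MemF f M) (hN : MemF f N) (e : M ≅ N) :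
    clsK f ⟨M, hM⟩ = clsK f ⟨N, hN⟩ := by
  rw [← sub_eq_zero, clsK_sub_clsK f hM hN e.hom,
    clsK_of_isZero f _ (isZero_kernel_of_mono e.hom),
    clsK_of_isZero f _ (isZero_cokernel_of_epi e.hom), sub_zero]

end Kgroup

/-! ### The dimension of the support and the filtration of the Grothendieck group -/

section dimension
variable {T : Type*} [TopologicalSpace T]

lemma topologicalKrullDim_mono {A B : Set T} (h : A ⊆ B) :
    topologicalKrullDim A ≤ topologicalKrullDim B :=
  (Topology.IsInducing.subtypeVal.of_comp (continuous_inclusion h) continuous_subtype_val :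
    Topology.IsInducing (Set.inclusion h)).topologicalKrullDim_le

lemma eq_empty_of_topologicalKrullDim_lt_zero {A : Set T} (h : topologicalKrullDim A < 0) :
    A = ∅ := by
  refine Set.eq_empty_of_forall_notMem fun x hx ↦ h.not_ge ?_
  have : Nonempty (IrreducibleCloseds A) :=
    ⟨⟨closure {⟨x, hx⟩}, isIrreducible_singleton.closure, isClosed_closure⟩⟩
  exact Order.krullDim_nonneg

/-- A proper closed subset of an irreducible set has smaller dimension. -/
lemma topologicalKrullDim_lt_of_isPreirreducible {A B : Set T} (hA : IsClosed A)
    (hB : IsPreirreducible B) (h : A ⊂ B) {k : ℕ} (hk : topologicalKrullDim B < (k + 1 : ℕ)) :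
    topologicalKrullDim A < k := by
  obtain ⟨b, hb⟩ := (Set.nonempty_of_ssubset h).mono Set.sdiff_subset
  have : PreirreducibleSpace B := Subtype.preirreducibleSpace hB
  have hi : Topology.IsInducing (Set.inclusion h.subset) :=
    Topology.IsInducing.subtypeVal.of_comp (continuous_inclusion h.subset) continuous_subtype_val
  -- the chains of irreducible closed subsets of `A` extend by `B` itself
  let top : IrreducibleCloseds B :=
    ⟨Set.univ, ⟨⟨⟨b, hb⟩, trivial⟩, PreirreducibleSpace.isPreirreducible_univ⟩, isClosed_univ⟩
  let m : IrreducibleCloseds A → IrreducibleCloseds B := IrreducibleCloseds.map _ hi.continuous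
  have hm : StrictMono m := IrreducibleCloseds.map_strictMono_of_isInducing hi
  have hlt (C : IrreducibleCloseds A) : m C < top := by
    rw [← SetLike.coe_ssubset_coe]
    refine ⟨Set.subset_univ _, fun hs ↦ h.2 fun z hz ↦ ?_⟩
    have : (m C : Set B) ⊆ Subtype.val ⁻¹' A :=
      closure_minimal (by rintro _ ⟨y, _, rfl⟩; exact y.2) (hA.preimage continuous_subtype_val)
    exact this (hs (Set.mem_univ ⟨z, hz⟩))
  rcases isEmpty_or_nonempty (IrreducibleCloseds A) with _ | _
  · rw [topologicalKrullDim, Order.krullDim_eq_bot]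
    exact WithBot.bot_lt_coe (k : ℕ∞)
  · let e : WithTop (IrreducibleCloseds A) → IrreducibleCloseds B :=
      fun C ↦ WithTop.recTopCoe top m C
    have he : StrictMono e := by
      intro C D hCD
      induction C using WithTop.recTopCoe with
      | top => exact absurd hCD not_top_lt
      | coe C =>
        induction D using WithTop.recTopCoe with
        | top => exact hlt C
        | coe D => exact hm (WithTop.coe_lt_coe.1 hCD)
    have := (Order.krullDim_le_of_strictMono e he).trans_lt hk
    rw [Order.krullDim_WithTop] at this
    push_cast at this
    exact lt_of_add_lt_add_right this

/-- Noetherian induction on the closed subsets contained in a Noetherian set. -/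
lemma noetherianSpace_induction {A : Set T} [NoetherianSpace A] (P : Set T → Prop)
    (h : ∀ Z ⊆ A, IsClosed Z → (∀ Z', IsClosed Z' → Z' ⊂ Z → P Z') → P Z) :
    ∀ Z ⊆ A, IsClosed Z → P Z := by
  have key (C : Closeds A) : ∀ Z ⊆ A, IsClosed Z → Subtype.val ⁻¹' Z = (C : Set A) → P Z := by
    induction C using WellFoundedLT.induction with
    | ind C ih =>
    intro Z hZA hZ hC
    refine h Z hZA hZ fun Z' hZ' hZZ' ↦ ih ⟨Subtype.val ⁻¹' Z', hZ'.preimage continuous_subtype_val⟩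
      ?_ Z' (hZZ'.subset.trans hZA) hZ' rfl
    rw [← SetLike.coe_ssubset_coe, ← hC]
    refine ⟨Set.preimage_mono hZZ'.subset, fun hs ↦ hZZ'.2 fun z hz ↦ @hs ⟨z, hZA hz⟩ hz⟩
  exact fun Z hZA hZ ↦ key ⟨_, hZ.preimage continuous_subtype_val⟩ Z hZA hZ rfl

end dimension

section filtration
variable {X S : Scheme.{u}} (f : X ⟶ S)

/-- The subgroup generated by the classes of the sheaves with support of dimension less than `k`:
the filtration `filK`, shifted so that it starts with `0`. -/
noncomputable def filLT (k : ℕ) : AddSubgroup (GrothK f) :=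
  AddSubgroup.closure {x | ∃ F : CohF f, topologicalKrullDim (supp F.1) < k ∧ x = clsK f F}

lemma clsK_mem_filLT {k : ℕ} {M : X.Modules} (hM : MemF f M)
    (h : topologicalKrullDim (supp M) < k) : clsK f ⟨M, hM⟩ ∈ filLT f k :=
  AddSubgroup.subset_closure ⟨⟨M, hM⟩, h, rfl⟩

lemma filK_eq_filLT (r : ℕ) : filK f r = filLT f (r + 1) := by
  have h (x : WithBot ℕ∞) : x ≤ (r : WithBot ℕ∞) ↔ x < ((r + 1 : ℕ) : WithBot ℕ∞) := by
    exact ENat.WithBot.lt_add_one_iff.symm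
  simp only [filK, filLT, h]

lemma filLT_zero : filLT f 0 = ⊥ := by
  rw [eq_bot_iff, filLT, AddSubgroup.closure_le]
  rintro _ ⟨F, hF, rfl⟩
  exact clsK_of_supp_eq_empty f F.2 (eq_empty_of_topologicalKrullDim_lt_zero (by simpa using hF))

variable [IsLocallyNoetherian X]

/-- If two sheaves with support in an irreducible closed set are isomorphic over an open subset that
meets it, then their classes agree up to the classes of sheaves with smaller support. -/
lemma clsK_sub_mem_of_iso {F E : X.Modules} (hF : MemF f F) (hE : MemF f E)
    (hs : supp E = supp F) (hirr : IsPreirreducible (supp F)) (U : X.Opens)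
    (φ : F.restrict U.ι ≅ E.restrict U.ι) (hU : ((U : Set X) ∩ supp F).Nonempty) {k : ℕ}
    (hk : topologicalKrullDim (supp F) < (k + 1 : ℕ)) :
    clsK f ⟨F, hF⟩ - clsK f ⟨E, hE⟩ ∈ filLT f k := by
  have hG := isCoherent_graph φ hF.1 hE.1
  have hGs : supp (graph φ) ⊆ supp F := by
    simpa [hs] using supp_graph_subset φ hF.1.isClosed_supp hE.1.isClosed_supp
  have hG' : MemF f (graph φ) := hF.of_supp_subset f hG hG.isClosed_supp hGs
  have mem {M : X.Modules} (hM : MemF f M) (h₁ : supp M ⊆ supp F)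
      (h₂ : Disjoint (U : Set X) (supp M)) : clsK f ⟨M, hM⟩ ∈ filLT f k := by
    refine clsK_mem_filLT f hM (topologicalKrullDim_lt_of_isPreirreducible hM.1.isClosed_supp hirr
      ⟨h₁, fun h ↦ ?_⟩ hk)
    obtain ⟨x, hxU, hx⟩ := hU
    exact Set.disjoint_left.1 h₂ hxU (h hx)
  obtain ⟨a₁, a₂⟩ := disjoint_supp_of_bijective (graphFst φ) U (graphFst_bijective φ)
  obtain ⟨b₁, b₂⟩ := disjoint_supp_of_bijective (graphSnd φ) U (graphSnd_bijective φ)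
  have hp := clsK_sub_clsK f hG' hF (graphFst φ)
  have hq := clsK_sub_clsK f hG' hE (graphSnd φ)
  have e : clsK f ⟨F, hF⟩ - clsK f ⟨E, hE⟩ = (clsK f ⟨graph φ, hG'⟩ - clsK f ⟨E, hE⟩) -
      (clsK f ⟨graph φ, hG'⟩ - clsK f ⟨F, hF⟩) := by abel
  rw [e, hp, hq]
  exact sub_mem
    (sub_mem (mem _ ((supp_subset_of_mono (kernel.ι _) hG.isClosed_supp).trans hGs) b₁)
      (mem _ ((supp_cokernel_subset _ hE.1.isClosed_supp).trans hs.subset) b₂))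
    (sub_mem (mem _ ((supp_subset_of_mono (kernel.ι _) hG.isClosed_supp).trans hGs) a₁)
      (mem _ (supp_cokernel_subset _ hF.1.isClosed_supp) a₂))

/-- The subsheaf of sections of `F` with support in `Z₂`, and the quotient by it. -/
lemma exists_devissage {F : X.Modules} (hF : MemF f F) {Z₁ Z₂ : Set X} (h₁ : IsClosed Z₁)
    (h₂ : IsClosed Z₂) (h : supp F ⊆ Z₁ ∪ Z₂) :
    ∃ (F' F'' : CohF f), clsK f ⟨F, hF⟩ = clsK f F' + clsK f F'' ∧
      supp F'.1 ⊆ supp F ∩ Z₂ ∧ supp F''.1 ⊆ supp F ∩ Z₁ := by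
  let U : X.Opens := ⟨Z₂ᶜ, h₂.isOpen_compl⟩
  have hF' : MemF f (sectionsOff F U) := hF.of_supp_subset f (hF.1.sectionsOff U)
    (hF.1.sectionsOff U).isClosed_supp (supp_subset_of_mono (sectionsOffι F U) hF.1.isClosed_supp)
  refine ⟨⟨_, hF'⟩, ⟨_, hF.cokernel f hF'.1 (sectionsOffι F U)⟩,
    clsK_mono f hF' hF (sectionsOffι F U), Set.subset_inter
      (supp_subset_of_mono (sectionsOffι F U) hF.1.isClosed_supp)
      (Set.disjoint_compl_left_iff_subset.1 (disjoint_supp_sectionsOff F U)), Set.subset_inter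
      (supp_cokernel_subset _ hF.1.isClosed_supp) (Set.disjoint_compl_left_iff_subset.1
        (disjoint_supp_cokernel_sectionsOffι F U ⟨Z₁ᶜ, h₁.isOpen_compl⟩ ?_))⟩
  exact Set.disjoint_left.2 fun x hx hx' ↦ (h hx').elim hx.2 hx.1

/-- Noetherian induction on the support reduces this to sheaves with irreducible support. -/
lemma clsK_sub_tensor_mem (L : Pic X) {F : X.Modules} (hF : MemF f F) {k : ℕ}
    (hk : topologicalKrullDim (supp F) < (k + 1 : ℕ)) :
    clsK f ⟨F, hF⟩ - tensorK f L (clsK f ⟨F, hF⟩) ∈ filLT f k := by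
  have := noetherianSpace_supp f hF
  refine noetherianSpace_induction (A := supp F) (fun Z ↦ ∀ F : X.Modules, ∀ hF : MemF f F,
    supp F = Z → topologicalKrullDim Z < (k + 1 : ℕ) →
      clsK f ⟨F, hF⟩ - tensorK f L (clsK f ⟨F, hF⟩) ∈ filLT f k) ?_ (supp F) le_rfl
      hF.1.isClosed_supp F hF rfl hk
  rintro _ - - ih F hF rfl hk
  by_cases hirr : IsPreirreducible (supp F)
  · obtain h | ⟨x, hx⟩ := (supp F).eq_empty_or_nonempty
    · rw [clsK_of_supp_eq_empty f hF h, map_zero, sub_zero]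
      exact zero_mem _
    · obtain ⟨U, hxU, hU⟩ := L.isLocallyTrivial x
      obtain ⟨φ⟩ := restrict_iso_of_over_iso U (over_tensor_iso U L.sheaf F hU)
      refine (congrArg (clsK f ⟨F, hF⟩ - · ∈ filLT f k) (tensorK_clsK f L ⟨F, hF⟩)).mpr ?_
      exact clsK_sub_mem_of_iso f hF (hF.tensor f L.isLocallyTrivial)
        (supp_tensor L.isLocallyTrivial) hirr U φ ⟨x, hxU, hx⟩ hk
  · rw [isPreirreducible_iff_isClosed_union_isClosed] at hirr
    push Not at hirr
    obtain ⟨Z₁, Z₂, hZ₁, hZ₂, hZ, h₁, h₂⟩ := hirr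
    obtain ⟨F', F'', e, h', h''⟩ := exists_devissage f hF hZ₁ hZ₂ hZ
    have a' := ih (supp F'.1) F'.2.1.isClosed_supp
      ⟨h'.trans Set.inter_subset_left, fun h ↦ h₂ ((h.trans h').trans Set.inter_subset_right)⟩
      F'.1 F'.2 rfl ((topologicalKrullDim_mono (h'.trans Set.inter_subset_left)).trans_lt hk)
    have a'' := ih (supp F''.1) F''.2.1.isClosed_supp
      ⟨h''.trans Set.inter_subset_left, fun h ↦ h₁ ((h.trans h'').trans Set.inter_subset_right)⟩
      F''.1 F''.2 rfl ((topologicalKrullDim_mono (h''.trans Set.inter_subset_left)).trans_lt hk)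
    rw [e, map_add, add_sub_add_comm]
    exact add_mem a' a''

/-- The operators `c₁` lower the filtration by the dimension of the support. -/
lemma c₁_mem_filLT (L : Pic X) {k : ℕ} {x : GrothK f} (hx : x ∈ filLT f (k + 1)) :
    c₁ f L x ∈ filLT f k := by
  suffices filLT f (k + 1) ≤ (filLT f k).comap (c₁ f L) from this hx
  rw [filLT, AddSubgroup.closure_le]
  rintro _ ⟨F, hF, rfl⟩
  exact clsK_sub_tensor_mem f L⁻¹ F.2 hF

end filtration

/-! ### The binomial expansion of commuting operators -/

section binomial

/-- The binomial expansion of `u ^ m = (1 - (1 - u⁻¹)) ^ (-m)`, on an element on which `1 - u⁻¹` is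
nilpotent. -/
lemma zpow_smul_eq_sum {R K : Type*} [Ring R] [AddCommGroup K] [Module R K] (u : Rˣ) (N : ℕ) (x : K)
    (hx : (1 - (u⁻¹ : Rˣ) : R) ^ N • x = 0) (m : ℤ) :
    ((u ^ m : Rˣ) : R) • x =
      ∑ i ∈ Finset.range N, Ring.multichoose m i • ((1 - (u⁻¹ : Rˣ) : R) ^ i • x) := by
  set c : R := 1 - (u⁻¹ : Rˣ) with hc
  let s (m : ℤ) : K := ∑ i ∈ Finset.range N, Ring.multichoose m i • (c ^ i • x)
  change _ = s m
  have h0 : s 0 = x := by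
    cases N with
    | zero => simpa [s] using hx.symm
    | succ N => simp [s, Finset.sum_range_succ', Ring.multichoose_zero_succ]
  -- both sides of the claim are multiplied by `u` if `m` increases by one
  have step (m : ℤ) : s m = ((u⁻¹ : Rˣ) : R) • s (m + 1) := by
    have h : s (m + 1) - s m = c • s (m + 1) := by
      cases N with
      | zero => simp [s]
      | succ N =>
        have e : c • s (m + 1) =
            ∑ i ∈ Finset.range (N + 1), Ring.multichoose (m + 1) i • (c ^ (i + 1) • x) := by
          simp only [s, Finset.smul_sum, smul_comm c, smul_smul, pow_succ']
        rw [e, Finset.sum_range_succ, hx, smul_zero, add_zero]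
        simp only [s, ← Finset.sum_sub_distrib, ← sub_smul]
        rw [Finset.sum_range_succ']
        simp [Ring.multichoose_succ_succ]
    have hu : ((u⁻¹ : Rˣ) : R) = 1 - c := by rw [hc, sub_sub_cancel]
    rw [hu, sub_smul, one_smul, ← h, sub_sub_cancel]
  have step' (m : ℤ) : (u : R) • s m = s (m + 1) := by
    rw [step m, smul_smul, Units.mul_inv, one_smul]
  induction m using Int.induction_on with
  | zero => simp [h0]
  | succ m ih => rw [add_comm, zpow_one_add, Units.val_mul, mul_smul, ih, step', add_comm]
  | pred m ih => rw [sub_eq_neg_add, zpow_add, zpow_neg_one, Units.val_mul, mul_smul, ih,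
      step (-1 + -(m : ℤ)), neg_add_cancel_comm]

variable {K G : Type*} [AddCommGroup K] [CommGroup G] (ρ : G →* AddMonoid.End K)
  (fil : ℕ → AddSubgroup K)

lemma apply_pow_mem (h0 : fil 0 = ⊥)
    (h : ∀ g k, ∀ x ∈ fil (k + 1), (1 - ρ g⁻¹) x ∈ fil k) (g : G) (a k : ℕ) (x : K)
    (hx : x ∈ fil k) : ((1 - ρ g⁻¹) ^ a) x ∈ fil (k - a) := by
  induction a generalizing k x with
  | zero => simpa using hx
  | succ a ih =>
    rw [pow_succ, AddMonoid.End.coe_mul, Function.comp_apply]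
    cases k with
    | zero =>
      rw [h0, AddSubgroup.mem_bot] at hx
      rw [hx, map_zero, map_zero]
      exact zero_mem _
    | succ k =>
      rw [Nat.add_sub_add_right]
      exact ih _ _ (h g k x hx)

/-- Each factor lowers the filtration by one. -/
lemma prod_apply_mem (h0 : fil 0 = ⊥)
    (h : ∀ g k, ∀ x ∈ fil (k + 1), (1 - ρ g⁻¹) x ∈ fil k) {n : ℕ} (g : Fin n → G) (i : Fin n → ℕ)
    (k : ℕ) (x : K) (hx : x ∈ fil k) :
    (List.ofFn fun j ↦ (1 - ρ (g j)⁻¹) ^ i j).prod x ∈ fil (k - ∑ j, i j) := by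
  induction n with
  | zero => simpa using hx
  | succ n ih =>
    rw [List.ofFn_succ, List.prod_cons, AddMonoid.End.coe_mul, Function.comp_apply,
      Fin.sum_univ_succ, add_comm, ← Nat.sub_sub]
    exact apply_pow_mem ρ fil h0 h _ _ _ _ (ih (fun j ↦ g j.succ) (fun j ↦ i j.succ))

/-- The expansion in several variables, as a sum over a box of exponents. -/
lemma map_prod_zpow_apply_eq_sum (h0 : fil 0 = ⊥) (hmono : Monotone fil)
    (h : ∀ g k, ∀ x ∈ fil (k + 1), (1 - ρ g⁻¹) x ∈ fil k) {n : ℕ} (g : Fin n → G) (m : Fin n → ℤ)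
    (N : ℕ) (x : K) (hx : x ∈ fil N) :
    ρ (∏ j, g j ^ m j) x = ∑ i ∈ Fintype.piFinset fun _ : Fin n ↦ Finset.range N,
      (∏ j, Ring.multichoose (m j) (i j)) • (List.ofFn fun j ↦ (1 - ρ (g j)⁻¹) ^ i j).prod x := by
  induction n with
  | zero => simp
  | succ n ih =>
    have hm : ρ (g 0 ^ m 0) = ((Units.map ρ (toUnits (g 0)) ^ m 0 : (AddMonoid.End K)ˣ) :
        AddMonoid.End K) := by
      rw [← map_zpow, ← map_zpow]; rfl
    have one (y : K) (hy : y ∈ fil N) := zpow_smul_eq_sum (Units.map ρ (toUnits (g 0))) N y (by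
      have := apply_pow_mem ρ fil h0 h (g 0) N N y hy
      rwa [Nat.sub_self, h0, AddSubgroup.mem_bot] at this) (m 0)
    rw [Fin.prod_univ_succ, map_mul, AddMonoid.End.coe_mul, Function.comp_apply,
      ih (fun j ↦ g j.succ) (fun j ↦ m j.succ)]
    have hset := Finset.filter_piFinset_eq_map_consEquiv (fun _ : Fin (n + 1) ↦ Finset.range N)
      (fun _ ↦ True)
    simp only [Finset.filter_true] at hset
    rw [hset, Finset.sum_map, Finset.sum_product_right, map_sum]
    refine Finset.sum_congr rfl fun i hi ↦ ?_
    have hy := hmono (Nat.sub_le _ _) (prod_apply_mem ρ fil h0 h (fun j ↦ g j.succ) i N x hx)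
    rw [map_zsmul, hm]
    refine (congrArg _ (one _ hy)).trans ?_
    rw [Finset.smul_sum]
    refine Finset.sum_congr rfl fun i0 hi0 ↦ ?_
    rw [smul_smul, mul_comm]
    simp [Fin.prod_univ_succ, List.ofFn_succ]

/-- The terms with more than `r` factors `1 - ρ g⁻¹` vanish, since these lower the filtration. -/
lemma map_prod_zpow_apply_eq_sum_filter (h0 : fil 0 = ⊥) (hmono : Monotone fil)
    (h : ∀ g k, ∀ x ∈ fil (k + 1), (1 - ρ g⁻¹) x ∈ fil k) {n : ℕ} (g : Fin n → G) (m : Fin n → ℤ)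
    (r : ℕ) (x : K) (hx : x ∈ fil (r + 1)) :
    ρ (∏ j, g j ^ m j) x = ∑ i ∈ (Fintype.piFinset fun _ : Fin n ↦ Finset.range (r + 1)).filter
        (fun i ↦ ∑ j, i j ≤ r),
      (∏ j, Ring.multichoose (m j) (i j)) • (List.ofFn fun j ↦ (1 - ρ (g j)⁻¹) ^ i j).prod x := by
  rw [map_prod_zpow_apply_eq_sum ρ fil h0 hmono h g m _ x hx, Finset.sum_filter_of_ne]
  intro i _ hi
  by_contra hlt
  have := prod_apply_mem ρ fil h0 h g i _ x hx
  rw [Nat.sub_eq_zero_of_le (by omega), h0, AddSubgroup.mem_bot] at this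
  exact hi (by rw [this, smul_zero])

/-- The polynomial function `m ↦ (m + k - 1).choose k` in the variable `j`. -/
noncomputable def multichoosePoly {n : ℕ} (j : Fin n) (k : ℕ) : MvPolynomial (Fin n) ℚ :=
  MvPolynomial.C ((k.factorial : ℚ)⁻¹) *
    ∏ t ∈ Finset.range k, (MvPolynomial.X j + MvPolynomial.C ((k : ℚ) - 1 - t))

lemma totalDegree_multichoosePoly {n : ℕ} (j : Fin n) (k : ℕ) :
    (multichoosePoly j k).totalDegree ≤ k := by
  refine (MvPolynomial.totalDegree_mul _ _).trans ?_
  rw [MvPolynomial.totalDegree_C, zero_add]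
  refine (MvPolynomial.totalDegree_finsetProd _ _).trans ?_
  refine (Finset.sum_le_card_nsmul _ _ 1 fun t _ ↦ ?_).trans (by simp)
  refine (MvPolynomial.totalDegree_add _ _).trans ?_
  rw [MvPolynomial.totalDegree_C, MvPolynomial.totalDegree_X]
  simp

lemma descPochhammer_smeval_eq_prod {R : Type*} [CommRing R] (a : R) (k : ℕ) :
    (descPochhammer ℤ k).smeval a = ∏ t ∈ Finset.range k, (a - t) := by
  induction k with
  | zero => simp
  | succ k ih =>
    rw [descPochhammer_succ_right, Polynomial.smeval_mul, ih, Finset.prod_range_succ,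
      Polynomial.smeval_sub, Polynomial.smeval_X, Polynomial.smeval_natCast]
    simp

lemma eval_multichoosePoly {n : ℕ} (j : Fin n) (k : ℕ) (m : Fin n → ℤ) :
    MvPolynomial.eval (fun j ↦ (m j : ℚ)) (multichoosePoly j k) =
      (Ring.choose (m j + (k : ℤ) - 1) k : ℤ) := by
  have h := Ring.map_choose (Int.castRingHom ℚ) (m j + (k : ℤ) - 1) k
  rw [eq_intCast, eq_intCast] at h
  rw [h, Ring.choose_eq_smul, descPochhammer_smeval_eq_prod, smul_eq_mul, multichoosePoly, map_mul,
    MvPolynomial.eval_C, map_prod]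
  congr 1
  refine Finset.prod_congr rfl fun t _ ↦ ?_
  simp
  ring

end binomial

/-! ### The action of the Picard group -/

section
variable {X S : Scheme.{u}} (f : X ⟶ S)

lemma Pic.nonempty_sheaf_mul_iso (L M : Pic X) :
    Nonempty ((L * M).sheaf ≅ L.sheaf ⊗ M.sheaf) :=
  Quotient.exact (Quotient.out_eq (L * M).1.1)

lemma Pic.nonempty_sheaf_one_iso : Nonempty ((1 : Pic X).sheaf ≅ 𝟙_ X.Modules) :=
  Quotient.exact (Quotient.out_eq (1 : Pic X).1.1)

lemma grothK_end_ext {φ ψ : AddMonoid.End (GrothK f)}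
    (h : ∀ F : CohF f, φ (clsK f F) = ψ (clsK f F)) : φ = ψ :=
  QuotientAddGroup.addMonoidHom_ext _ (FreeAbelianGroup.lift_ext _ _ h)

lemma tensorK_mul [IsLocallyNoetherian X] (L M : Pic X) :
    tensorK f (L * M) = tensorK f L * tensorK f M := by
  refine grothK_end_ext f fun F ↦ ?_
  obtain ⟨e⟩ := Pic.nonempty_sheaf_mul_iso L M
  rw [AddMonoid.End.coe_mul, Function.comp_apply, tensorK_clsK, tensorK_clsK, tensorK_clsK]
  exact clsK_of_iso f _ _ (whiskerRightIso e F.1 ≪≫ α_ _ _ _)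

lemma tensorK_one [IsLocallyNoetherian X] : tensorK f 1 = 1 := by
  refine grothK_end_ext f fun F ↦ ?_
  obtain ⟨e⟩ := Pic.nonempty_sheaf_one_iso (X := X)
  rw [tensorK_clsK]
  exact clsK_of_iso f _ F.2 (whiskerRightIso e F.1 ≪≫ λ_ _)

/-- The action of the Picard group on the Grothendieck group. -/
noncomputable def tensorKHom [IsLocallyNoetherian X] : Pic X →* AddMonoid.End (GrothK f) where
  toFun := tensorK f
  map_one' := tensorK_one f
  map_mul' := tensorK_mul f

lemma filLT_mono : Monotone (filLT f) := fun k l h ↦ AddSubgroup.closure_mono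
  fun _ ⟨F, hF, e⟩ ↦ ⟨F, hF.trans_le (by exact_mod_cast h), e⟩

end

end Snapper

theorem theoremB {X S : AlgebraicGeometry.Scheme.{u}} (f : X ⟶ S)
    [AlgebraicGeometry.IsLocallyNoetherian S] [AlgebraicGeometry.IsSeparated f]
    [AlgebraicGeometry.LocallyOfFiniteType f] [AlgebraicGeometry.QuasiCompact f]
    (n r : ℕ) (L : Fin n → Snapper.Pic X) (F : Snapper.GrothK f) (hF : F ∈ Snapper.filK f r) :
    (∃ p : MvPolynomial (Fin n) ℚ, p.totalDegree ≤ r ∧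
      ∀ m : Fin n → ℤ,
        ((Snapper.χ f (Snapper.tensorK f (∏ j, L j ^ m j) F) : ℤ) : ℚ) =
          MvPolynomial.eval (fun j ↦ (m j : ℚ)) p) ∧
    ∀ m : Fin n → ℤ,
      Snapper.χ f (Snapper.tensorK f (∏ j, L j ^ m j) F) =
        ∑ i ∈ (Fintype.piFinset fun _ : Fin n ↦ Finset.range (r + 1)).filter
            (fun i ↦ ∑ j, i j ≤ r),
          Snapper.χ f ((List.ofFn fun j ↦ Snapper.c₁ f (L j) ^ i j).prod F) *
            ∏ j, Ring.choose (m j + (i j : ℤ) - 1) (i j) := by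
  have : AlgebraicGeometry.IsLocallyNoetherian X :=
    AlgebraicGeometry.LocallyOfFiniteType.isLocallyNoetherian f
  rw [Snapper.filK_eq_filLT] at hF
  have formula (m : Fin n → ℤ) : Snapper.χ f (Snapper.tensorK f (∏ j, L j ^ m j) F) =
        ∑ i ∈ (Fintype.piFinset fun _ : Fin n ↦ Finset.range (r + 1)).filter
            (fun i ↦ ∑ j, i j ≤ r),
          Snapper.χ f ((List.ofFn fun j ↦ Snapper.c₁ f (L j) ^ i j).prod F) *
            ∏ j, Ring.choose (m j + (i j : ℤ) - 1) (i j) := by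
    refine (congrArg (Snapper.χ f) (Snapper.map_prod_zpow_apply_eq_sum_filter (Snapper.tensorKHom f)
      (Snapper.filLT f) (Snapper.filLT_zero f) (Snapper.filLT_mono f)
      (fun L k x hx ↦ Snapper.c₁_mem_filLT f L hx) L m r F hF)).trans ?_
    rw [map_sum]
    refine Finset.sum_congr rfl fun i _ ↦ ?_
    rw [map_zsmul, smul_eq_mul, mul_comm]
    simp only [Ring.multichoose_eq]
    rfl
  refine ⟨⟨∑ i ∈ (Fintype.piFinset fun _ : Fin n ↦ Finset.range (r + 1)).filter
      (fun i ↦ ∑ j, i j ≤ r), MvPolynomial.C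
        ((Snapper.χ f ((List.ofFn fun j ↦ Snapper.c₁ f (L j) ^ i j).prod F) : ℤ) : ℚ) *
        ∏ j, Snapper.multichoosePoly j (i j), ?_, fun m ↦ ?_⟩, formula⟩
  · refine (MvPolynomial.totalDegree_finsetSum _ _).trans (Finset.sup_le fun i hi ↦ ?_)
    refine (MvPolynomial.totalDegree_mul _ _).trans ?_
    rw [MvPolynomial.totalDegree_C, zero_add]
    refine (MvPolynomial.totalDegree_finsetProd _ _).trans ?_
    exact (Finset.sum_le_sum fun j _ ↦ Snapper.totalDegree_multichoosePoly j (i j)).trans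
      (Finset.mem_filter.1 hi).2
  · rw [formula, map_sum]
    push_cast
    refine Finset.sum_congr rfl fun i _ ↦ ?_
    rw [map_mul, MvPolynomial.eval_C, map_prod]
    simp only [Snapper.eval_multichoosePoly]
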